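/- Let $H$ be a closed, densely defined linear operator on a complex Banach space $\mathcal B$ with spectrum $\sigma(H)\subseteq\mathbb R$, such that for some constants $c$ and $\alpha\ge 0$ $$\|(z-H)^{-1}\|\le c\,|\operatorname{Im}z|^{-1}\Big(\frac{\langle z\rangle}{|\operatorname{Im}z|}\Big)^{\alpha}\qquad\text{for all } z\notin\mathbb R,\qquad \langle z\rangle:=(1+|z|^2)^{1/2}.$$ Let $\mathcal A=\bigcup_{\beta<0}S^\beta$, where $S^\beta$ is the set of smooth $f:\mathbb R\to\mathbb C$ such that for every $m\ge 0$ there is a constant $c_m$ with $|f^{(m)}(x)|\le c_m\langle x\rangle^{\beta-m}$ for all $x\in\mathbb R$. Let $n>\alpha$ be an integer, and let $\tau(x,y)$ be a smooth function on $\mathbb R^2$ with $\tau=1$ where $|y|\le\langle x\rangle$, $\tau=0$ where $|y|\ge 2\langle x\rangle$, and first derivatives bounded by a constant multiple of $\langle x\rangle^{-1}$ (for instance $\tau(x,y)=\tau_0(y/\langle x\rangle)$ with $\tau_0$ smooth). For $f\in\mathcal A$ put $$\tilde f(x,y)=\Big(\sum_{r=0}^n f^{(r)}(x)\frac{(iy)^r}{r!}\Big)\tau(x,y),\qquad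 \frac{\partial\tilde f}{\partial\bar z}=\frac12\Big(\frac{\partial\tilde f}{\partial x}+i\frac{\partial\tilde f}{\partial y}\Big),\qquad f(H)=-\frac1\pi\iint_{\mathbb C}\frac{\partial\tilde f}{\partial\bar z}\,(z-H)^{-1}\,dx\,dy .$$ Let $\hat{\mathcal A}$ be the set of pairs $\phi=(c,f)$ with $c\in\mathbb C$ and $f\in\mathcal A$, with $\phi(x)=c+f(x)$ for $x\in\mathbb R$ and $\phi(H)=cI+f(H)$. Then, for every $\phi=(c,f)\in\hat{\mathcal A}$, the integral defining $f(H)$ is absolutely convergent in operator norm, $$\overline{\phi(\sigma(H))}\subseteq\sigma(\phi(H)),$$ and, in fact, $\sigma(\phi(H))=\overline{\phi(\sigma(H))}$. -/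

import Mathlib

open MeasureTheory
open scoped ContDiff

noncomputable section

namespace HelfferSjostrand

/-- The Japanese bracket `⟨x⟩ = (1 + |x|²)^{1/2}`, used for real and for complex `x`. -/
def bracket {E : Type*} [Norm E] (x : E) : ℝ := Real.sqrt (1 + ‖x‖ ^ 2)

section Operators

variable {B : Type*} [NormedAddCommGroup B] [NormedSpace ℂ B]

/-- `R` is the bounded two-sided inverse `(z - H)⁻¹` of `z - H : Dom(H) → B`. -/
def IsResolventAt (H : B →ₗ.[ℂ] B) (z : ℂ) (R : B →L[ℂ] B) : Prop :=
  (∀ v : B, ∃ u : H.domain, (u : B) = R v ∧ z • (u : B) - H u = v) ∧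
    ∀ u : H.domain, R (z • (u : B) - H u) = u

/-- The spectrum `σ(H)` of a (possibly unbounded) operator: the set of the complex `z` for which
`z - H` has no bounded inverse. -/
def opSpectrum (H : B →ₗ.[ℂ] B) : Set ℂ := {z | ¬ ∃ R : B →L[ℂ] B, IsResolventAt H z R}

open Classical in
/-- The resolvent operator `(z - H)⁻¹`, for `z` outside the spectrum (and `0` otherwise). -/
def opResolvent (H : B →ₗ.[ℂ] B) (z : ℂ) : B →L[ℂ] B :=
  if h : ∃ R : B →L[ℂ] B, IsResolventAt H z R then h.choose else 0

/-- `H` is closed and densely defined, its spectrum is real, and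
`‖(z - H)⁻¹‖ ≤ c |Im z|⁻¹ (⟨z⟩ / |Im z|) ^ α` for all non-real `z`, where `α ≥ 0`. -/
structure Admissible (H : B →ₗ.[ℂ] B) (α : ℝ) : Prop where
  isClosed : H.IsClosed
  dense_domain : Dense (H.domain : Set B)
  spectrum_real : ∀ z ∈ opSpectrum H, z.im = 0
  exponent_nonneg : 0 ≤ α
  resolvent_bound : ∃ c : ℝ, ∀ z : ℂ, z.im ≠ 0 →
    ‖opResolvent H z‖ ≤ c * |z.im|⁻¹ * (bracket z / |z.im|) ^ α

end Operators

/-- `f ∈ S^β`: `f` is smooth and `|f⁽ᵐ⁾(x)| ≤ c_m ⟨x⟩^(β - m)` for every `m`. -/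
def MemS (β : ℝ) (f : ℝ → ℂ) : Prop :=
  ContDiff ℝ ∞ f ∧ ∀ m : ℕ, ∃ c : ℝ, ∀ x : ℝ, ‖iteratedDeriv m f x‖ ≤ c * bracket x ^ (β - m)

/-- `f ∈ 𝒜`, the union of the `S^β` with `β < 0`. -/
def MemA (f : ℝ → ℂ) : Prop := ∃ β : ℝ, β < 0 ∧ MemS β f

/-- The set `Â` of the pairs `(c, f)` with `c ∈ ℂ` and `f ∈ 𝒜`. -/
structure AHat where
  const : ℂ
  fn : ℝ → ℂ
  fn_mem : MemA fn

/-- The function `x ↦ c + f(x)` given by `φ = (c, f) ∈ Â`. -/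
def AHat.eval (φ : AHat) (x : ℝ) : ℂ := φ.const + φ.fn x

/-- Cut-off functions: smooth `τ` (as a function of `x = Re z` and `y = Im z`) which is `1` where
`|y| ≤ ⟨x⟩` and `0` where `|y| ≥ 2⟨x⟩`, with first derivatives of size `O(⟨x⟩⁻¹)`. The usual
`τ(x, y) = τ₀(y / ⟨x⟩)`, with `τ₀` smooth, is of this kind. -/
structure IsCutoff (τ : ℂ → ℂ) : Prop where
  smooth : ContDiff ℝ ∞ τ
  eq_one : ∀ z : ℂ, |z.im| ≤ bracket z.re → τ z = 1
  eq_zero : ∀ z : ℂ, 2 * bracket z.re ≤ |z.im| → τ z = 0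
  deriv_bound : ∃ C : ℝ, ∀ z : ℂ, ‖fderiv ℝ τ z‖ ≤ C / bracket z.re

/-- The almost analytic extension `f̃(x, y) = (∑_{r ≤ n} f⁽ʳ⁾(x) (iy)ʳ / r!) τ(x, y)`. -/
def almostAnalytic (n : ℕ) (τ : ℂ → ℂ) (f : ℝ → ℂ) (z : ℂ) : ℂ :=
  (∑ r ∈ Finset.range (n + 1),
    iteratedDeriv r f z.re * (Complex.I * (z.im : ℂ)) ^ r / (r.factorial : ℂ)) * τ z

/-- `∂F/∂z̄ = (∂F/∂x + i ∂F/∂y) / 2`. -/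
def dbar (F : ℂ → ℂ) (z : ℂ) : ℂ :=
  (1 / 2) * (fderiv ℝ F z 1 + Complex.I * fderiv ℝ F z Complex.I)

section Calculus

variable {B : Type*} [NormedAddCommGroup B] [NormedSpace ℂ B]

/-- The integrand `(∂f̃/∂z̄)(z) (z - H)⁻¹`. -/
def integrand (H : B →ₗ.[ℂ] B) (n : ℕ) (τ : ℂ → ℂ) (f : ℝ → ℂ) (z : ℂ) : B →L[ℂ] B :=
  dbar (almostAnalytic n τ f) z • opResolvent H z

/-- `f(H) = -(1/π) ∬ (∂f̃/∂z̄) (z - H)⁻¹ dx dy`. -/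
def opCalc (H : B →ₗ.[ℂ] B) (n : ℕ) (τ : ℂ → ℂ) (f : ℝ → ℂ) : B →L[ℂ] B :=
  (-(1 / Real.pi) : ℝ) • ∫ z : ℂ, integrand H n τ f z

/-- `φ(H) = c I + f(H)` for `φ = (c, f) ∈ Â`. -/
def calcHat (H : B →ₗ.[ℂ] B) (n : ℕ) (τ : ℂ → ℂ) (φ : AHat) : B →L[ℂ] B :=
  φ.const • ContinuousLinearMap.id ℂ B + opCalc H n τ φ.fn

/-- The image `φ(σ(H))` of the (real) spectrum of `H`. -/
def specImage (H : B →ₗ.[ℂ] B) (φ : AHat) : Set ℂ :=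
  φ.eval '' {x : ℝ | (x : ℂ) ∈ opSpectrum H}

end Calculus

end HelfferSjostrand

end

/-!
The proof goes through Gelfand theory instead of the multiplicativity of `f ↦ f(H)`.

Write `T = (i - H)⁻¹`. All resolvents `(w - H)⁻¹ = T (1 + (w - i) T)⁻¹`, and hence also the integral
`φ(H)`, lie in the bicommutant of `T`, a commutative Banach algebra in which an element is
invertible as soon as it is invertible as an operator. So `σ(φ(H))` is the set of the values
`g(φ(H))`, for `g` a character of this algebra (`exists_bicommutantCharacter`).

If `g(T) ≠ 0`, then `g((w - H)⁻¹) = (w - l)⁻¹` with `l = i - 1 / g(T)`, and `l` runs exactly through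
`σ(H)` as `g` varies. Applying `g` under the integral sign turns `f(H)` into the same integral with
the scalar kernel `(z - l)⁻¹`, which the Cauchy–Pompeiu formula evaluates to `f(l)`
(`integral_dbar_almostAnalytic`); so `g(φ(H)) = φ(l)`.

If `g(T) = 0`, then `g` annihilates every resolvent and `g(φ(H)) = c`, the value of `φ` at infinity.
This value is in the closure of `φ(σ(H))` because `σ(H)` is then unbounded
(`exists_norm_ge_mem_opSpectrum`): if it were bounded, the Riesz projection `(2πi)⁻¹ ∮ (w - H)⁻¹ dw`
would be the identity (`circleIntegral_opResolvent`), which `g` cannot annihilate. The resolvent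
estimate enters here through a Liouville theorem, `eq_zero_of_norm_le_im`.

Absolute convergence (`integrable_dbar_smul`) follows from the bound
`|∂f̃/∂z̄| ≤ C ⟨x⟩^(β - 1) (|y| / ⟨x⟩)ⁿ`, valid on the support `|y| ≤ 2⟨x⟩`. Together with the
resolvent estimate it leaves the power `|y|^(n - 1 - α)`, which is integrable at `0` since `n > α`.
-/

noncomputable section

namespace HelfferSjostrand

/-! ### Characters of a bicommutant -/

section Bicommutant

variable {A : Type*} [NormedRing A] [NormedAlgebra ℂ A]

/-- The bicommutant of `T`: a commutative, closed and inverse-closed subalgebra containing `T`. -/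
def bicommutant (T : A) : Subalgebra ℂ A :=
  Subalgebra.centralizer ℂ (Subalgebra.centralizer ℂ ({T} : Set A) : Set A)

lemma mem_bicommutant_iff {T a : A} :
    a ∈ bicommutant T ↔ ∀ s : A, Commute T s → Commute s a := by
  simp only [bicommutant, Subalgebra.mem_centralizer_iff, SetLike.mem_coe,
    Set.mem_singleton_iff, forall_eq]
  rfl

lemma self_mem_bicommutant (T : A) : T ∈ bicommutant T :=
  mem_bicommutant_iff.2 fun _ h => h.symm

lemma bicommutant_commute {T a b : A} (ha : a ∈ bicommutant T) (hb : b ∈ bicommutant T) :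
    Commute a b :=
  mem_bicommutant_iff.1 hb a (mem_bicommutant_iff.1 ha T (Commute.refl T))

lemma inverse_mem_bicommutant {T a : A} (ha : a ∈ bicommutant T) :
    Ring.inverse a ∈ bicommutant T := by
  by_cases hu : IsUnit a
  · obtain ⟨u, rfl⟩ := hu
    rw [Ring.inverse_unit]
    exact mem_bicommutant_iff.2 fun s hs => (mem_bicommutant_iff.1 ha s hs).units_inv_right
  · rw [Ring.inverse_non_unit a hu]
    exact zero_mem _

instance (T : A) : NormedCommRing (bicommutant T) :=
  { (inferInstance : NormedRing (bicommutant T)) with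
    mul_comm := fun a b => Subtype.ext (bicommutant_commute a.2 b.2) }

instance [CompleteSpace A] (T : A) : CompleteSpace (bicommutant T) :=
  (Set.isClosed_centralizer _).completeSpace_coe

/-- `g` restricts to a character of the bicommutant of `T`. Keeping `g` defined on the whole of `A`
lets it pass through integrals with values in `A`. -/
structure IsBicommutantCharacter (T : A) (g : A →L[ℂ] ℂ) : Prop where
  map_one : g 1 = 1
  map_mul : ∀ a ∈ bicommutant T, ∀ b ∈ bicommutant T, g (a * b) = g a * g b

/-- Gelfand theory in the bicommutant, followed by a Hahn–Banach extension: non-invertible elements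
are annihilated by a character. -/
lemma exists_bicommutantCharacter [CompleteSpace A] {T a : A} (ha : a ∈ bicommutant T)
    (hu : ¬ IsUnit a) : ∃ g : A →L[ℂ] ℂ, IsBicommutantCharacter T g ∧ g a = 0 := by
  have hu' : ¬ IsUnit (⟨a, ha⟩ : bicommutant T) := fun h => hu (h.map (bicommutant T).val)
  obtain ⟨χ, hχ⟩ := WeakDual.CharacterSpace.exists_apply_eq_zero hu'
  obtain ⟨g, hg, -⟩ := exists_extension_norm_eq (Subalgebra.toSubmodule (bicommutant T))
    (WeakDual.CharacterSpace.toCLM χ)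
  have hg' : ∀ x (hx : x ∈ bicommutant T), g x = χ ⟨x, hx⟩ := fun x hx => hg ⟨x, hx⟩
  refine ⟨g, ⟨?_, fun x hx y hy => ?_⟩, by rw [hg' a ha, hχ]⟩
  · rw [hg' 1 (one_mem _)]
    exact map_one χ
  · rw [hg' x hx, hg' y hy, hg' _ (mul_mem hx hy), ← map_mul χ]
    rfl

lemma IsBicommutantCharacter.map_inverse {T a : A} {g : A →L[ℂ] ℂ}
    (hg : IsBicommutantCharacter T g) (ha : a ∈ bicommutant T) (hu : IsUnit a) :
    g a * g (Ring.inverse a) = 1 := by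
  rw [← hg.map_mul a ha _ (inverse_mem_bicommutant ha), Ring.mul_inverse_cancel a hu, hg.map_one]

lemma IsBicommutantCharacter.map_algebraMap {T : A} {g : A →L[ℂ] ℂ}
    (hg : IsBicommutantCharacter T g) (z : ℂ) : g (algebraMap ℂ A z) = z := by
  rw [Algebra.algebraMap_eq_smul_one, map_smul, hg.map_one, smul_eq_mul, mul_one]

lemma integral_mem_bicommutant [CompleteSpace A] {X : Type*} [MeasurableSpace X] {μ : Measure X}
    {T : A} {F : X → A} (hF : Integrable F μ) (h : ∀ x, F x ∈ bicommutant T) :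
    ∫ x, F x ∂μ ∈ bicommutant T := by
  refine mem_bicommutant_iff.2 fun s hs => ?_
  have h1 := (ContinuousLinearMap.mul ℂ A s).integral_comp_comm hF
  have h2 := ((ContinuousLinearMap.mul ℂ A).flip s).integral_comp_comm hF
  simp only [ContinuousLinearMap.mul_apply', ContinuousLinearMap.flip_apply] at h1 h2
  rw [Commute, SemiconjBy, ← h1, ← h2]
  exact integral_congr_ae (.of_forall fun x => mem_bicommutant_iff.1 (h x) s hs)

end Bicommutant

/-! ### The resolvent as a function of one bounded operator -/

section Resolvent

variable {B : Type*} [NormedAddCommGroup B] [NormedSpace ℂ B] {H : B →ₗ.[ℂ] B}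

lemma IsResolventAt.eq {z : ℂ} {R R' : B →L[ℂ] B} (h : IsResolventAt H z R)
    (h' : IsResolventAt H z R') : R = R' := by
  ext v
  obtain ⟨u, hu, huv⟩ := h.1 v
  rw [← hu, ← huv, h'.2]

lemma isResolventAt_opResolvent {z : ℂ} (hz : z ∉ opSpectrum H) :
    IsResolventAt H z (opResolvent H z) := by
  have h : ∃ R : B →L[ℂ] B, IsResolventAt H z R := not_not.1 hz
  rw [opResolvent, dif_pos h]
  exact h.choose_spec

lemma IsResolventAt.injective {z : ℂ} {R : B →L[ℂ] B} (h : IsResolventAt H z R) {v : B}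
    (hv : R v = 0) : v = 0 := by
  obtain ⟨u, hu, huv⟩ := h.1 v
  have : u = 0 := Subtype.ext (by rw [hu, hv]; rfl)
  rw [← huv, this]
  simp

/-- The first resolvent identity. -/
lemma IsResolventAt.sub_eq {z w : ℂ} {R S : B →L[ℂ] B} (hR : IsResolventAt H z R)
    (hS : IsResolventAt H w S) : R - S = (w - z) • (R * S) := by
  ext v
  obtain ⟨u, hu, huv⟩ := hS.1 v
  have h := hR.2 u
  have e : z • (u : B) - H u = v - (w - z) • S v := by
    rw [← hu, ← huv]; module
  rw [e, hu, map_sub, map_smul] at h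
  simp only [sub_apply, smul_apply, mul_apply_eq_comp]
  calc R v - S v = R v - (R v - (w - z) • R (S v)) := by rw [h]
    _ = (w - z) • R (S v) := sub_sub_cancel _ _

/-- If `T = (z₀ - H)⁻¹` then `1 + (w - z₀) T` is `(w - H) (z₀ - H)⁻¹`; its invertibility decides
whether `w` belongs to the spectrum of `H`. -/
def pencil (T : B →L[ℂ] B) (z₀ w : ℂ) : B →L[ℂ] B := 1 + (w - z₀) • T

variable {z₀ : ℂ} {T : B →L[ℂ] B}

lemma pencil_mul_resolvent (hT : IsResolventAt H z₀ T) {w : ℂ} {R : B →L[ℂ] B}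
    (hR : IsResolventAt H w R) :
    pencil T z₀ w * (1 - (w - z₀) • R) = 1 ∧ (1 - (w - z₀) • R) * pencil T z₀ w = 1 := by
  have h1 := hT.sub_eq hR
  have h2 := hR.sub_eq hT
  constructor
  · simp only [pencil, add_mul, mul_sub, one_mul, mul_one, smul_mul_assoc, mul_smul_comm]
    rw [← h1]; module
  · have h3 : (w - z₀) • (R * T) = T - R := by
      rw [← neg_sub z₀ w, neg_smul, ← h2]; abel
    simp only [pencil, sub_mul, mul_add, one_mul, mul_one, smul_mul_assoc, mul_smul_comm]
    rw [h3]; module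

lemma isResolventAt_of_isUnit_pencil (hT : IsResolventAt H z₀ T) {w : ℂ}
    (hu : IsUnit (pencil T z₀ w)) :
    IsResolventAt H w (T * Ring.inverse (pencil T z₀ w)) := by
  constructor
  · intro v
    set x := Ring.inverse (pencil T z₀ w) v with hx
    obtain ⟨u, h1, h2⟩ := hT.1 x
    refine ⟨u, by rw [h1]; rfl, ?_⟩
    have h3 : pencil T z₀ w x = v := by
      rw [hx, ← mul_apply_eq_comp, Ring.mul_inverse_cancel _ hu]; rfl
    rw [← h3]
    simp only [pencil, add_apply, one_apply_eq_self,
      smul_apply]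
    rw [← h1]
    calc w • (u : B) - H u = (z₀ • (u : B) - H u) + (w - z₀) • (u : B) := by module
      _ = x + (w - z₀) • (u : B) := by rw [h2]
  · intro u
    have h1 := hT.2 u
    have h2 : w • (u : B) - H u = pencil T z₀ w (z₀ • (u : B) - H u) := by
      simp only [pencil, add_apply, one_apply_eq_self,
        smul_apply, h1]
      rw [sub_smul]; abel
    rw [h2, mul_apply_eq_comp, ← mul_apply_eq_comp (Ring.inverse _),
      Ring.inverse_mul_cancel _ hu]
    exact h1

lemma isUnit_pencil_iff (hT : IsResolventAt H z₀ T) {w : ℂ} :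
    IsUnit (pencil T z₀ w) ↔ w ∉ opSpectrum H := by
  refine ⟨fun h h' => h' ⟨_, isResolventAt_of_isUnit_pencil hT h⟩, fun h => ?_⟩
  obtain ⟨h1, h2⟩ := pencil_mul_resolvent hT (isResolventAt_opResolvent h)
  exact ⟨⟨_, _, h1, h2⟩, rfl⟩

lemma opResolvent_eq (hT : IsResolventAt H z₀ T) {w : ℂ} (hw : w ∉ opSpectrum H) :
    opResolvent H w = T * Ring.inverse (pencil T z₀ w) :=
  (isResolventAt_opResolvent hw).eq
    (isResolventAt_of_isUnit_pencil hT ((isUnit_pencil_iff hT).2 hw))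

lemma differentiableAt_pencil (w : ℂ) : DifferentiableAt ℂ (pencil T z₀) w := by
  unfold pencil; fun_prop

lemma isOpen_compl_opSpectrum [CompleteSpace B] (hT : IsResolventAt H z₀ T) :
    IsOpen (opSpectrum H)ᶜ := by
  have h : (opSpectrum H)ᶜ = pencil T z₀ ⁻¹' {a | IsUnit a} := by
    ext w; exact (isUnit_pencil_iff hT).symm
  rw [h]
  exact Units.isOpen.preimage
    (Differentiable.continuous (𝕜 := ℂ) fun w => differentiableAt_pencil w)

lemma differentiableAt_opResolvent [CompleteSpace B] (hT : IsResolventAt H z₀ T) {w : ℂ}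
    (hw : w ∉ opSpectrum H) : DifferentiableAt ℂ (opResolvent H) w := by
  have h : DifferentiableAt ℂ (fun w => T * Ring.inverse (pencil T z₀ w)) w :=
    (differentiableAt_const T).mul
      ((differentiableAt_inverse ((isUnit_pencil_iff hT).2 hw)).comp w (differentiableAt_pencil w))
  refine h.congr_of_eventuallyEq ?_
  filter_upwards [(isOpen_compl_opSpectrum hT).mem_nhds hw] with z hz
  exact opResolvent_eq hT hz

lemma pencil_mem_bicommutant (w : ℂ) : pencil T z₀ w ∈ bicommutant T :=
  add_mem (one_mem _) (Subalgebra.smul_mem _ (self_mem_bicommutant T) _)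

lemma opResolvent_mem_bicommutant (hT : IsResolventAt H z₀ T) (w : ℂ) :
    opResolvent H w ∈ bicommutant T := by
  by_cases hw : w ∈ opSpectrum H
  · rw [opResolvent, dif_neg hw]
    exact zero_mem _
  · rw [opResolvent_eq hT hw]
    exact mul_mem (self_mem_bicommutant T) (inverse_mem_bicommutant (pencil_mem_bicommutant w))

namespace IsBicommutantCharacter

variable {g : (B →L[ℂ] B) →L[ℂ] ℂ}

lemma map_pencil (hg : IsBicommutantCharacter T g) (w : ℂ) :
    g (pencil T z₀ w) = 1 + (w - z₀) * g T := by
  rw [pencil, map_add, map_smul, hg.map_one, smul_eq_mul]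

lemma map_opResolvent_eq_zero (hg : IsBicommutantCharacter T g) (hT : IsResolventAt H z₀ T)
    (h : g T = 0) (w : ℂ) : g (opResolvent H w) = 0 := by
  by_cases hw : w ∈ opSpectrum H
  · rw [opResolvent, dif_neg hw, map_zero]
  · rw [opResolvent_eq hT hw, hg.map_mul T (self_mem_bicommutant T) _
      (inverse_mem_bicommutant (pencil_mem_bicommutant w)), h, zero_mul]

/-- A character that does not annihilate the resolvent is evaluation at the point
`z₀ - 1 / g(T)`. -/
lemma map_opResolvent (hg : IsBicommutantCharacter T g) (hT : IsResolventAt H z₀ T)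
    (h : g T ≠ 0) {w : ℂ} (hw : w ∉ opSpectrum H) :
    g (opResolvent H w) = (w - (z₀ - (g T)⁻¹))⁻¹ := by
  have h1 := hg.map_inverse (pencil_mem_bicommutant w) ((isUnit_pencil_iff hT).2 hw)
  rw [hg.map_pencil] at h1
  rw [opResolvent_eq hT hw, hg.map_mul T (self_mem_bicommutant T) _
      (inverse_mem_bicommutant (pencil_mem_bicommutant w))]
  refine eq_inv_of_mul_eq_one_left ?_
  rw [← h1]
  field_simp
  ring

lemma point_mem_opSpectrum (hg : IsBicommutantCharacter T g) (hT : IsResolventAt H z₀ T)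
    (h : g T ≠ 0) : z₀ - (g T)⁻¹ ∈ opSpectrum H := by
  by_contra hw
  have h1 := hg.map_inverse (pencil_mem_bicommutant _) ((isUnit_pencil_iff hT).2 hw)
  rw [hg.map_pencil] at h1
  have : 1 + (z₀ - (g T)⁻¹ - z₀) * g T = 0 := by field_simp; ring
  rw [this, zero_mul] at h1
  exact zero_ne_one h1

end IsBicommutantCharacter

/-- Every point of the spectrum of `H` is the point of evaluation of a character. -/
lemma exists_character_of_mem_opSpectrum [CompleteSpace B] (hT : IsResolventAt H z₀ T) {l : ℂ}
    (hl : l ∈ opSpectrum H) :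
    ∃ g : (B →L[ℂ] B) →L[ℂ] ℂ, IsBicommutantCharacter T g ∧ g T ≠ 0 ∧ z₀ - (g T)⁻¹ = l := by
  obtain ⟨g, hg, h0⟩ := exists_bicommutantCharacter (pencil_mem_bicommutant (T := T) (z₀ := z₀) l)
    (fun h => (isUnit_pencil_iff hT).1 h hl)
  rw [hg.map_pencil] at h0
  have hgT : g T ≠ 0 := by
    rintro h
    simp [h] at h0
  refine ⟨g, hg, hgT, ?_⟩
  have : (l - z₀) * g T = -1 := by linear_combination h0
  field_simp
  linear_combination -this

end Resolvent

/-! ### Operators with bounded spectrum -/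

lemma bracket_pos {E : Type*} [NormedAddCommGroup E] (x : E) : 0 < bracket x :=
  Real.sqrt_pos.2 (by positivity)

lemma one_le_bracket {E : Type*} [NormedAddCommGroup E] (x : E) : 1 ≤ bracket x :=
  Real.one_le_sqrt.2 (by nlinarith [sq_nonneg ‖x‖])

lemma sq_bracket {E : Type*} [NormedAddCommGroup E] (x : E) : bracket x ^ 2 = 1 + ‖x‖ ^ 2 :=
  Real.sq_sqrt (by positivity)

lemma norm_le_bracket {E : Type*} [NormedAddCommGroup E] (x : E) : ‖x‖ ≤ bracket x :=
  Real.le_sqrt_of_sq_le (by linarith)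

lemma abs_im_le_bracket (z : ℂ) : |z.im| ≤ bracket z :=
  (Complex.abs_im_le_norm z).trans (norm_le_bracket z)

/-- A Liouville theorem: an entire function growing at most like a power of `⟨z⟩ / |Im z|` times
`|Im z|⁻¹` vanishes. The blow-up at the two real points of the circle `|z| = ρ` is compensated by
the factor `(z² - ρ²)ⁿ⁺¹`. -/
theorem eq_zero_of_norm_le_im {E : Type*} [NormedAddCommGroup E] [NormedSpace ℂ E] {G : ℂ → E}
    (hG : Differentiable ℂ G) {C r : ℝ} {n : ℕ}
    (h : ∀ z : ℂ, r ≤ ‖z‖ → z.im ≠ 0 → ‖G z‖ ≤ C * |z.im|⁻¹ * (bracket z / |z.im|) ^ n) (z₀ : ℂ) :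
    G z₀ = 0 := by
  have key : ∀ ρ : ℝ, 1 ≤ ρ → r ≤ ρ → 2 * ‖z₀‖ ≤ ρ →
      ‖G z₀‖ * ρ ≤ |C| * 2 ^ (2 * n + 1) * 2 ^ (n + 1) := by
    intro ρ h1 hr h2
    have hρ : 0 < ρ := by linarith
    have hmax : ‖(z₀ ^ 2 - (ρ : ℂ) ^ 2) ^ (n + 1) • G z₀‖ ≤ |C| * (2 * ρ) ^ (2 * n + 1) := by
      refine Complex.norm_le_of_forall_mem_frontier_norm_le (U := Metric.ball 0 ρ)
        (f := fun z => (z ^ 2 - (ρ : ℂ) ^ 2) ^ (n + 1) • G z)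
        Metric.isBounded_ball ?_ ?_ (subset_closure ?_)
      · apply Differentiable.diffContOnCl
        fun_prop
      · intro z hz
        rw [frontier_ball _ hρ.ne', mem_sphere_zero_iff_norm] at hz
        have hfac : z ^ 2 - (ρ : ℂ) ^ 2 = z * (2 * z.im * Complex.I) := by
          have : (ρ : ℂ) ^ 2 = z * starRingEnd ℂ z := by
            rw [Complex.mul_conj, Complex.normSq_eq_norm_sq, hz]; push_cast; rfl
          rw [this]
          have h3 := Complex.sub_conj z
          push_cast at h3
          rw [← h3]; ring
        by_cases hy : z.im = 0
        · rw [hfac, hy]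
          simp
          positivity
        have hy' : 0 < |z.im| := abs_pos.2 hy
        have hb : bracket z ≤ 2 * ρ := by
          refine Real.sqrt_le_iff.2 ⟨by linarith, ?_⟩
          rw [hz]; nlinarith
        have hn : ‖z ^ 2 - (ρ : ℂ) ^ 2‖ = 2 * ρ * |z.im| := by
          rw [hfac]; simp [hz]; ring
        rw [norm_smul, norm_pow, hn]
        calc (2 * ρ * |z.im|) ^ (n + 1) * ‖G z‖
            ≤ (2 * ρ * |z.im|) ^ (n + 1) * (|C| * |z.im|⁻¹ * ((2 * ρ) / |z.im|) ^ n) := by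
              refine mul_le_mul_of_nonneg_left ((h z (hr.trans hz.ge) hy).trans ?_) (by positivity)
              have := bracket_pos z
              gcongr
              exact le_abs_self C
          _ = |C| * (2 * ρ) ^ (2 * n + 1) := by
              rw [div_pow, mul_pow (2 * ρ) |z.im|]
              field_simp
              ring
      · rw [mem_ball_zero_iff]
        nlinarith [norm_nonneg z₀]
    have hlow : ρ ^ 2 / 2 ≤ ‖z₀ ^ 2 - (ρ : ℂ) ^ 2‖ := by
      have h3 : ‖(ρ : ℂ) ^ 2‖ - ‖z₀ ^ 2‖ ≤ ‖(ρ : ℂ) ^ 2 - z₀ ^ 2‖ := norm_sub_norm_le _ _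
      rw [norm_sub_rev] at h3
      rw [norm_pow, norm_pow, Complex.norm_real, Real.norm_eq_abs, abs_of_pos hρ] at h3
      nlinarith [norm_nonneg z₀]
    rw [norm_smul, norm_pow] at hmax
    have h4 : (ρ ^ 2 / 2) ^ (n + 1) * ‖G z₀‖ ≤ |C| * (2 * ρ) ^ (2 * n + 1) :=
      (mul_le_mul_of_nonneg_right (pow_le_pow_left₀ (by positivity) hlow _)
        (norm_nonneg _)).trans hmax
    have h5 : (ρ ^ 2 / 2) ^ (n + 1) = ρ ^ (2 * n + 1) * ρ / 2 ^ (n + 1) := by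
      rw [div_pow, ← pow_mul]; ring
    rw [h5, mul_pow] at h4
    have h6 : 0 < ρ ^ (2 * n + 1) := by positivity
    refine le_of_mul_le_mul_left ?_ h6
    have h7 := mul_le_mul_of_nonneg_right h4 (by positivity : (0 : ℝ) ≤ 2 ^ (n + 1))
    calc ρ ^ (2 * n + 1) * (‖G z₀‖ * ρ)
        = ρ ^ (2 * n + 1) * ρ / 2 ^ (n + 1) * ‖G z₀‖ * 2 ^ (n + 1) := by field_simp
      _ ≤ _ := h7
      _ = _ := by ring
  by_contra hne
  have hpos : 0 < ‖G z₀‖ := norm_pos_iff.2 hne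
  set K := |C| * 2 ^ (2 * n + 1) * 2 ^ (n + 1) with hK
  have hK0 : 0 ≤ K := by positivity
  have := key (1 + |r| + 2 * ‖z₀‖ + K / ‖G z₀‖)
    (by have := abs_nonneg r; have := norm_nonneg z₀; have : 0 ≤ K / ‖G z₀‖ := by positivity
        linarith)
    (by have := le_abs_self r; have := norm_nonneg z₀; have : 0 ≤ K / ‖G z₀‖ := by positivity
        linarith)
    (by have := abs_nonneg r; have : 0 ≤ K / ‖G z₀‖ := by positivity
        linarith)
  have h8 : ‖G z₀‖ * (K / ‖G z₀‖) = K := by field_simp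
  rw [mul_add, h8] at this
  have h9 : 0 < ‖G z₀‖ * (1 + |r| + 2 * ‖z₀‖) := by positivity
  linarith

section BoundedSpectrum

variable {B : Type*} [NormedAddCommGroup B] [NormedSpace ℂ B] [CompleteSpace B] {H : B →ₗ.[ℂ] B}

/-- If the spectrum of `H` is bounded, the Riesz projection of the whole spectrum is the identity:
the complementary projection `Q` makes `(z - H)⁻¹ Q` extend to an entire function, which vanishes by
the resolvent estimate. -/
theorem circleIntegral_opResolvent {α : ℝ} (hH : Admissible H α) {r : ℝ} (hr : 0 < r)
    (hspec : ∀ z ∈ opSpectrum H, ‖z‖ < r) :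
    (∮ w in C(0, r + 1), opResolvent H w) = (2 * Real.pi * Complex.I : ℂ) • (1 : B →L[ℂ] B) := by
  have hI : Complex.I ∉ opSpectrum H := fun h => by
    have := hH.spectrum_real _ h; simp at this
  have hT := isResolventAt_opResolvent hI
  have hout : ∀ z : ℂ, r ≤ ‖z‖ → z ∉ opSpectrum H := fun z hz h => (hspec z h).not_ge hz
  have hcont : ContinuousOn (opResolvent H) (Metric.sphere 0 (r + 1)) := fun z hz =>
    (differentiableAt_opResolvent hT (hout z (by
      rw [mem_sphere_zero_iff_norm] at hz; linarith))).continuousAt.continuousWithinAt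
  have hci : CircleIntegrable (opResolvent H) 0 (r + 1) :=
    hcont.circleIntegrable (by linarith)
  set κ : ℂ := (2 * Real.pi * Complex.I)⁻¹ with hκ
  have hκ0 : (2 * Real.pi * Complex.I : ℂ) ≠ 0 := Complex.two_pi_I_ne_zero
  set P : B →L[ℂ] B := κ • ∮ w in C(0, r + 1), opResolvent H w with hP
  set E : ℂ → (B →L[ℂ] B) := fun z => κ • ∮ w in C(0, r + 1), (w - z)⁻¹ • opResolvent H w with hE
  have hEdiff : DifferentiableOn ℂ E (Metric.ball 0 (r + 1)) := by
    obtain ⟨R, hR⟩ : ∃ R : NNReal, (R : ℝ) = r + 1 := ⟨⟨r + 1, by linarith⟩, rfl⟩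
    have hs := (hasFPowerSeriesOn_cauchy_integral (R := R) (by rwa [hR])
      (by rw [← NNReal.coe_pos, hR]; linarith)).differentiableOn
    rw [Metric.eball_coe] at hs
    simpa only [hR] using hs
  -- Integrate the first resolvent identity against `(w - z)⁻¹`.
  have hER : ∀ z : ℂ, ‖z‖ < r + 1 → z ∉ opSpectrum H → E z = opResolvent H z * (1 - P) := by
    intro z hz hzs
    have hRz := isResolventAt_opResolvent hzs
    have hint : (∮ w in C(0, r + 1), (w - z)⁻¹ • opResolvent H w)
        = ∮ w in C(0, r + 1), ((w - z)⁻¹ • opResolvent H z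
            - ContinuousLinearMap.mul ℂ _ (opResolvent H z) (opResolvent H w)) := by
      refine circleIntegral.integral_congr (by linarith) fun w hw => ?_
      rw [mem_sphere_zero_iff_norm] at hw
      have hwz : w - z ≠ 0 := sub_ne_zero.2 fun h => by rw [h] at hw; linarith
      have h1 := hRz.sub_eq (isResolventAt_opResolvent (hout w (by linarith)))
      have h2 : opResolvent H w
          = opResolvent H z - (w - z) • (opResolvent H z * opResolvent H w) := by
        rw [← h1]; abel
      simp only [ContinuousLinearMap.mul_apply']
      nth_rewrite 1 [h2]
      rw [smul_sub, smul_smul, inv_mul_cancel₀ hwz, one_smul]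
    have hz' : z ∈ Metric.ball (0 : ℂ) (r + 1) := by rwa [mem_ball_zero_iff]
    have hsc : ContinuousOn (fun w : ℂ => (w - z)⁻¹) (Metric.sphere 0 (r + 1)) := by
      refine ContinuousOn.inv₀ (by fun_prop) fun w hw h => ?_
      rw [mem_sphere_zero_iff_norm, sub_eq_zero.1 h] at hw
      linarith
    have hmul : (∮ w in C(0, r + 1),
        ContinuousLinearMap.mul ℂ _ (opResolvent H z) (opResolvent H w))
        = opResolvent H z * ∮ w in C(0, r + 1), opResolvent H w := by
      have hi : IntervalIntegrable (fun θ : ℝ => deriv (circleMap 0 (r + 1)) θ •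
          opResolvent H (circleMap 0 (r + 1) θ)) volume 0 (2 * Real.pi) := hci.out
      have := (ContinuousLinearMap.mul ℂ _ (opResolvent H z)).intervalIntegral_comp_comm hi
      simpa only [circleIntegral, map_smul, ContinuousLinearMap.mul_apply'] using this
    rw [hE]
    simp only
    rw [hint, circleIntegral.integral_sub, circleIntegral.integral_smul_const,
      circleIntegral.integral_sub_inv_of_mem_ball hz', hmul, hP, smul_sub, smul_smul,
      inv_mul_cancel₀ hκ0, one_smul, mul_sub, mul_one, mul_smul_comm]
    · exact (hsc.smul continuousOn_const).circleIntegrable (by linarith)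
    · exact ((ContinuousLinearMap.continuous _).comp_continuousOn hcont).circleIntegrable
        (by linarith)
  -- The two formulas agree on the annulus, so `G` is entire and extends `(z - H)⁻¹ (1 - P)`.
  set G : ℂ → (B →L[ℂ] B) := fun z => if ‖z‖ < r + 1 then E z else opResolvent H z * (1 - P)
    with hG
  have hGR : ∀ z, z ∉ opSpectrum H → G z = opResolvent H z * (1 - P) := by
    intro z hz
    by_cases h : ‖z‖ < r + 1
    · simp only [hG, if_pos h]; exact hER z h hz
    · simp only [hG, if_neg h]
  have hGdiff : Differentiable ℂ G := by
    intro z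
    by_cases h : ‖z‖ < r + 1
    · have hb : Metric.ball (0 : ℂ) (r + 1) ∈ nhds z :=
        Metric.isOpen_ball.mem_nhds (by rwa [mem_ball_zero_iff])
      refine (hEdiff.differentiableAt hb).congr_of_eventuallyEq ?_
      filter_upwards [hb] with w hw
      rw [mem_ball_zero_iff] at hw
      simp only [hG, if_pos hw]
    · have hz : z ∉ opSpectrum H := hout z (by linarith)
      refine ((differentiableAt_opResolvent hT hz).mul
        (differentiableAt_const (1 - P))).congr_of_eventuallyEq ?_
      filter_upwards [(isOpen_compl_opSpectrum hT).mem_nhds hz] with w hw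
      exact hGR w hw
  obtain ⟨c, hc⟩ := hH.resolvent_bound
  obtain ⟨n, hn⟩ := exists_nat_ge α
  have hzero : G Complex.I = 0 := by
    refine eq_zero_of_norm_le_im hGdiff (C := |c| * ‖1 - P‖) (r := 0) (n := n)
      (fun z _ hy => ?_) _
    have hy' : 0 < |z.im| := abs_pos.2 hy
    have hbr := bracket_pos z
    have hrat : 1 ≤ bracket z / |z.im| := (one_le_div hy').2 (abs_im_le_bracket z)
    rw [hGR z fun h => hy (hH.spectrum_real z h)]
    calc ‖opResolvent H z * (1 - P)‖ ≤ ‖opResolvent H z‖ * ‖1 - P‖ := norm_mul_le _ _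
      _ ≤ (|c| * |z.im|⁻¹ * (bracket z / |z.im|) ^ n) * ‖1 - P‖ := by
          refine mul_le_mul_of_nonneg_right ((hc z hy).trans ?_) (norm_nonneg _)
          rw [← Real.rpow_natCast]
          gcongr
          exact le_abs_self c
      _ = _ := by ring
  rw [hGR _ hI] at hzero
  have hQ : 1 - P = 0 := by
    ext v
    refine hT.injective ?_
    rw [← mul_apply_eq_comp, hzero]
    simp
  have hP1 : P = 1 := (sub_eq_zero.1 hQ).symm
  rw [← hP1, hP, smul_smul, mul_inv_cancel₀ hκ0, one_smul]

/-- A character annihilating the resolvent stands for the point at infinity, which lies in the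
extended spectrum only if the spectrum is unbounded. -/
theorem exists_norm_ge_mem_opSpectrum {α : ℝ} (hH : Admissible H α) {T : B →L[ℂ] B} {z₀ : ℂ}
    (hT : IsResolventAt H z₀ T) {g : (B →L[ℂ] B) →L[ℂ] ℂ} (hg : IsBicommutantCharacter T g)
    (h0 : g T = 0) {r : ℝ} (hr : 0 < r) : ∃ z ∈ opSpectrum H, r ≤ ‖z‖ := by
  by_contra! hcon
  have h1 := circleIntegral_opResolvent hH hr hcon
  have hci : IntervalIntegrable (fun θ : ℝ => deriv (circleMap 0 (r + 1)) θ •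
      opResolvent H (circleMap 0 (r + 1) θ)) volume 0 (2 * Real.pi) := by
    have hc : ContinuousOn (opResolvent H) (Metric.sphere 0 (r + 1)) := fun z hz =>
      (differentiableAt_opResolvent hT fun h => by
        have := hcon z h
        rw [mem_sphere_zero_iff_norm] at hz
        linarith).continuousAt.continuousWithinAt
    exact (hc.circleIntegrable (by linarith)).out
  have h2 := g.intervalIntegral_comp_comm hci
  simp only [map_smul, hg.map_opResolvent_eq_zero hT h0, smul_zero,
    intervalIntegral.integral_zero] at h2
  have h3 : g (∮ w in C(0, r + 1), opResolvent H w) = 0 := h2.symm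
  rw [h1, map_smul, hg.map_one, smul_eq_mul, mul_one] at h3
  exact Complex.two_pi_I_ne_zero h3

end BoundedSpectrum

/-! ### Almost analytic extensions -/

lemma dbar_add {F G : ℂ → ℂ} {z : ℂ} (hF : DifferentiableAt ℝ F z) (hG : DifferentiableAt ℝ G z) :
    dbar (fun z => F z + G z) z = dbar F z + dbar G z := by
  simp only [dbar, fderiv_fun_add hF hG, add_apply]
  ring

lemma dbar_mul {F G : ℂ → ℂ} {z : ℂ} (hF : DifferentiableAt ℝ F z) (hG : DifferentiableAt ℝ G z) :
    dbar (fun z => F z * G z) z = dbar F z * G z + F z * dbar G z := by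
  simp only [dbar, fderiv_fun_mul hF hG, add_apply, smul_apply, smul_eq_mul]
  ring

lemma norm_dbar_le (F : ℂ → ℂ) (z : ℂ) : ‖dbar F z‖ ≤ ‖fderiv ℝ F z‖ := by
  have h1 := (fderiv ℝ F z).le_opNorm 1
  have h2 := (fderiv ℝ F z).le_opNorm Complex.I
  have h3 := norm_add_le (fderiv ℝ F z 1) (Complex.I * fderiv ℝ F z Complex.I)
  rw [norm_mul, Complex.norm_I, one_mul] at h3
  simp only [norm_one, Complex.norm_I, mul_one] at h1 h2
  rw [dbar, norm_mul]
  norm_num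
  linarith

lemma dbar_eq_zero_of_eventuallyEq_const {F : ℂ → ℂ} {z c : ℂ} (h : F =ᶠ[nhds z] fun _ => c) :
    dbar F z = 0 := by
  simp [dbar, h.fderiv_eq]

/-- The Taylor polynomial of `f` at `x`, evaluated at the imaginary increment `iy`. -/
def taylorExt (n : ℕ) (f : ℝ → ℂ) (z : ℂ) : ℂ :=
  ∑ r ∈ Finset.range (n + 1),
    iteratedDeriv r f z.re * (Complex.I * (z.im : ℂ)) ^ r / (r.factorial : ℂ)

section Smooth

variable {f : ℝ → ℂ} (hf : ContDiff ℝ ∞ f)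
include hf

lemma contDiff_iteratedDeriv (r : ℕ) : ContDiff ℝ ∞ (iteratedDeriv r f) := by
  rw [iteratedDeriv_eq_iterate]
  exact hf.iterate_deriv r

lemma contDiff_taylorExt (n : ℕ) : ContDiff ℝ ∞ (taylorExt n f) := by
  refine ContDiff.sum fun r _ => ContDiff.div_const (ContDiff.mul ?_ ?_) _
  · exact (contDiff_iteratedDeriv hf r).comp Complex.reCLM.contDiff
  · exact (contDiff_const.mul (Complex.ofRealCLM.contDiff.comp Complex.imCLM.contDiff)).pow r

lemma dbar_iteratedDeriv_re (r : ℕ) (z : ℂ) :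
    dbar (fun z => iteratedDeriv r f z.re) z = 1 / 2 * iteratedDeriv (r + 1) f z.re := by
  have h1 : HasDerivAt (iteratedDeriv r f) (iteratedDeriv (r + 1) f z.re) z.re := by
    rw [iteratedDeriv_succ]
    exact ((contDiff_iteratedDeriv hf r).differentiable (by simp) _).hasDerivAt
  have h2 : HasFDerivAt (fun z : ℂ => iteratedDeriv r f z.re) _ z :=
    h1.hasFDerivAt.comp z Complex.reCLM.hasFDerivAt
  simp [dbar, h2.fderiv]

omit hf in
lemma dbar_pow_im (r : ℕ) (z : ℂ) :
    dbar (fun z : ℂ => (Complex.I * (z.im : ℂ)) ^ (r + 1)) z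
      = -(1 / 2) * ((r + 1) * (Complex.I * (z.im : ℂ)) ^ r) := by
  have h1 : HasFDerivAt (fun z : ℂ => (z.im : ℂ)) (Complex.ofRealCLM.comp Complex.imCLM) z :=
    (Complex.ofRealCLM.comp Complex.imCLM).hasFDerivAt
  have h2 := (h1.const_mul Complex.I).pow (r + 1)
  simp [dbar, h2.fderiv]
  linear_combination (1 / 2 * (r + 1) * (Complex.I * (z.im : ℂ)) ^ r) * Complex.I_mul_I

/-- Successive terms of the Taylor polynomial cancel under `∂/∂z̄`, so only the last derivative
survives. -/
lemma dbar_taylorExt (n : ℕ) (z : ℂ) :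
    dbar (taylorExt n f) z = 1 / 2 * (iteratedDeriv (n + 1) f z.re *
      (Complex.I * (z.im : ℂ)) ^ n / (n.factorial : ℂ)) := by
  induction n with
  | zero =>
    have : taylorExt 0 f = fun z => iteratedDeriv 0 f z.re := by
      ext w; simp [taylorExt]
    rw [this, dbar_iteratedDeriv_re hf]
    simp
  | succ n ih =>
    have hA : DifferentiableAt ℝ (fun z : ℂ => iteratedDeriv (n + 1) f z.re) z :=
      ((contDiff_iteratedDeriv hf (n + 1)).comp Complex.reCLM.contDiff).differentiable (by simp) z
    have hB : DifferentiableAt ℝ (fun z : ℂ => (Complex.I * (z.im : ℂ)) ^ (n + 1)) z :=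
      ((contDiff_const.mul (Complex.ofRealCLM.contDiff.comp Complex.imCLM.contDiff)).pow
        (n + 1)).differentiable (n := ∞) (by simp) z
    have hsucc : taylorExt (n + 1) f = fun z => taylorExt n f z +
        (iteratedDeriv (n + 1) f z.re * (Complex.I * (z.im : ℂ)) ^ (n + 1)) *
          ((n + 1).factorial : ℂ)⁻¹ := by
      ext w
      rw [taylorExt, Finset.sum_range_succ, div_eq_mul_inv]
      rfl
    have hc : dbar (fun _ : ℂ => ((n + 1).factorial : ℂ)⁻¹) z = 0 :=
      dbar_eq_zero_of_eventuallyEq_const (.refl _ _)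
    rw [hsucc, dbar_add ((contDiff_taylorExt hf n).differentiable (by simp) z)
      ((hA.fun_mul hB).mul_const _), ih, dbar_mul (hA.fun_mul hB) (differentiableAt_const _), hc,
      dbar_mul hA hB, dbar_iteratedDeriv_re hf, dbar_pow_im, Nat.factorial_succ]
    have h1 : (n.factorial : ℂ) ≠ 0 := by exact_mod_cast n.factorial_ne_zero
    have h2 : (n : ℂ) + 1 ≠ 0 := by exact_mod_cast n.succ_ne_zero
    push_cast
    field_simp
    ring

lemma contDiff_almostAnalytic {τ : ℂ → ℂ} (hτ : IsCutoff τ) (n : ℕ) :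
    ContDiff ℝ ∞ (almostAnalytic n τ f) :=
  (contDiff_taylorExt hf n).mul hτ.smooth

end Smooth

lemma almostAnalytic_ofReal {τ : ℂ → ℂ} (hτ : IsCutoff τ) (n : ℕ) (f : ℝ → ℂ) (x : ℝ) :
    almostAnalytic n τ f x = f x := by
  have h : τ x = 1 := hτ.eq_one _ (by simpa using (bracket_pos (x : ℝ)).le)
  rw [almostAnalytic, h, mul_one, Finset.sum_range_succ']
  simp

/-- A cut-off is bounded: at height at most `2⟨x⟩` compare with its value `1` at the real
point below, along a vertical segment on which the derivative is `O(⟨x⟩⁻¹)`. -/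
lemma IsCutoff.norm_le {τ : ℂ → ℂ} (hτ : IsCutoff τ) : ∃ M : ℝ, 0 ≤ M ∧ ∀ z, ‖τ z‖ ≤ M := by
  obtain ⟨C, hC⟩ := hτ.deriv_bound
  refine ⟨1 + |C| * 2, by positivity, fun z => ?_⟩
  rcases le_total (2 * bracket z.re) |z.im| with h | h
  · rw [hτ.eq_zero z h, norm_zero]; positivity
  have hb := bracket_pos z.re
  have hconv : Convex ℝ {w : ℂ | w.re = z.re} := by
    intro u hu v hv a b _ _ hab
    simp only [Set.mem_ofPred_eq, Complex.add_re, Complex.real_smul, Complex.re_ofReal_mul] at *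
    rw [hu, hv, ← add_mul, hab, one_mul]
  have hmv := hconv.norm_image_sub_le_of_norm_fderiv_le (𝕜 := ℝ) (f := τ)
    (C := |C| / bracket z.re) (x := (z.re : ℂ)) (y := z)
    (fun w _ => hτ.smooth.differentiable (by simp) w)
    (fun w hw => by
      rw [← show w.re = z.re from hw]
      exact (hC w).trans (div_le_div_of_nonneg_right (le_abs_self C) (bracket_pos w.re).le))
    (by simp) rfl
  have h1 : τ (z.re : ℂ) = 1 := hτ.eq_one _ (by simpa using hb.le)
  have h2 : ‖z - (z.re : ℂ)‖ = |z.im| := by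
    have : z - (z.re : ℂ) = z.im * Complex.I := by
      rw [sub_eq_iff_eq_add, add_comm, Complex.re_add_im]
    rw [this]; simp
  rw [h1, h2] at hmv
  have h3 : |C| / bracket z.re * |z.im| ≤ |C| * 2 := by
    rw [div_mul_eq_mul_div, div_le_iff₀ hb]
    nlinarith [abs_nonneg C]
  calc ‖τ z‖ = ‖1 + (τ z - 1)‖ := by ring_nf
    _ ≤ 1 + ‖τ z - 1‖ := (norm_add_le _ _).trans (by simp)
    _ ≤ _ := by linarith

lemma norm_taylorExt_le {β : ℝ} {f : ℝ → ℂ} (hf : MemS β f) (n : ℕ) :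
    ∃ C : ℝ, 0 ≤ C ∧ ∀ z : ℂ, |z.im| ≤ 2 * bracket z.re →
      ‖taylorExt n f z‖ ≤ C * bracket z.re ^ β := by
  choose c hc using hf.2
  refine ⟨∑ r ∈ Finset.range (n + 1), |c r| * 2 ^ r, by positivity, fun z hz => ?_⟩
  have hb := bracket_pos z.re
  rw [taylorExt, Finset.sum_mul]
  refine norm_sum_le_of_le _ fun r _ => ?_
  rw [norm_div, norm_mul, norm_pow, norm_mul, Complex.norm_I, one_mul, Complex.norm_real,
    Real.norm_eq_abs, Complex.norm_natCast]
  have hfac : (1 : ℝ) ≤ r.factorial := by exact_mod_cast r.factorial_pos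
  calc ‖iteratedDeriv r f z.re‖ * |z.im| ^ r / r.factorial
      ≤ ‖iteratedDeriv r f z.re‖ * |z.im| ^ r := div_le_self (by positivity) hfac
    _ ≤ (|c r| * bracket z.re ^ (β - r)) * (2 * bracket z.re) ^ r := by
        refine mul_le_mul ((hc r z.re).trans ?_) (pow_le_pow_left₀ (abs_nonneg _) hz r)
          (by positivity) (by positivity)
        exact mul_le_mul_of_nonneg_right (le_abs_self _) (by positivity)
    _ = |c r| * 2 ^ r * bracket z.re ^ β := by
        rw [Real.rpow_sub hb, Real.rpow_natCast, mul_pow]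
        field_simp

lemma continuous_bracket {E : Type*} [NormedAddCommGroup E] :
    Continuous (bracket : E → ℝ) := by
  unfold bracket; fun_prop

lemma IsCutoff.dbar_eq_zero {τ : ℂ → ℂ} (hτ : IsCutoff τ) {z : ℂ} (h : |z.im| < bracket z.re) :
    dbar τ z = 0 := by
  refine dbar_eq_zero_of_eventuallyEq_const (c := 1) ?_
  have ho : IsOpen {w : ℂ | |w.im| < bracket w.re} :=
    isOpen_lt (by fun_prop) (continuous_bracket.comp Complex.continuous_re)
  filter_upwards [ho.mem_nhds h] with w hw
  exact hτ.eq_one w (le_of_lt hw)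

lemma dbar_almostAnalytic_eq_zero {τ : ℂ → ℂ} (hτ : IsCutoff τ) (n : ℕ) (f : ℝ → ℂ) {z : ℂ}
    (h : 2 * bracket z.re < |z.im|) : dbar (almostAnalytic n τ f) z = 0 := by
  refine dbar_eq_zero_of_eventuallyEq_const (c := 0) ?_
  have ho : IsOpen {w : ℂ | 2 * bracket w.re < |w.im|} :=
    isOpen_lt (continuous_const.mul (continuous_bracket.comp Complex.continuous_re)) (by fun_prop)
  filter_upwards [ho.mem_nhds h] with w hw
  rw [almostAnalytic, hτ.eq_zero w (le_of_lt hw), mul_zero]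

/-- `∂f̃/∂z̄` vanishes to order `n` at the real axis. -/
lemma norm_dbar_almostAnalytic_le {β : ℝ} {f : ℝ → ℂ} (hf : MemS β f) {τ : ℂ → ℂ}
    (hτ : IsCutoff τ) (n : ℕ) :
    ∃ C : ℝ, 0 ≤ C ∧ ∀ z : ℂ, |z.im| ≤ 2 * bracket z.re →
      ‖dbar (almostAnalytic n τ f) z‖ ≤
        C * bracket z.re ^ (β - 1) * (|z.im| / bracket z.re) ^ n := by
  obtain ⟨M, hM0, hM⟩ := hτ.norm_le
  obtain ⟨D, hD⟩ := hτ.deriv_bound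
  obtain ⟨K, hK0, hK⟩ := norm_taylorExt_le hf n
  obtain ⟨c, hc⟩ := hf.2 (n + 1)
  refine ⟨|c| * M + K * |D|, by positivity, fun z hz => ?_⟩
  have hb := bracket_pos z.re
  have h1 : dbar (almostAnalytic n τ f) z
      = dbar (taylorExt n f) z * τ z + taylorExt n f z * dbar τ z :=
    dbar_mul ((contDiff_taylorExt hf.1 n).differentiable (by simp) z)
      (hτ.smooth.differentiable (by simp) z)
  have h2 : ‖dbar (taylorExt n f) z‖ ≤ |c| * bracket z.re ^ (β - 1) *
      (|z.im| / bracket z.re) ^ n := by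
    rw [dbar_taylorExt hf.1, norm_mul, norm_div (_ * _), norm_mul (iteratedDeriv _ _ _),
      norm_pow, norm_mul, Complex.norm_I, one_mul, Complex.norm_real, Real.norm_eq_abs,
      Complex.norm_natCast]
    have hfac : (1 : ℝ) ≤ n.factorial := by exact_mod_cast n.factorial_pos
    calc ‖(1 / 2 : ℂ)‖ * (‖iteratedDeriv (n + 1) f z.re‖ * |z.im| ^ n / n.factorial)
        ≤ 1 * (‖iteratedDeriv (n + 1) f z.re‖ * |z.im| ^ n) := by
          refine mul_le_mul (by norm_num) (div_le_self (by positivity) hfac) (by positivity)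
            zero_le_one
      _ ≤ (|c| * bracket z.re ^ (β - (n + 1 : ℕ))) * |z.im| ^ n := by
          rw [one_mul]
          refine mul_le_mul_of_nonneg_right ((hc z.re).trans ?_) (by positivity)
          exact mul_le_mul_of_nonneg_right (le_abs_self _) (by positivity)
      _ = _ := by
          have : β - (n + 1 : ℕ) = β - 1 - n := by push_cast; ring
          rw [this, Real.rpow_sub hb (β - 1), Real.rpow_natCast, div_pow]
          field_simp
  have h3 : ‖taylorExt n f z * dbar τ z‖ ≤ K * |D| * bracket z.re ^ (β - 1) *
      (|z.im| / bracket z.re) ^ n := by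
    rcases lt_or_ge |z.im| (bracket z.re) with h | h
    · rw [hτ.dbar_eq_zero h, mul_zero, norm_zero]; positivity
    have h4 : ‖dbar τ z‖ ≤ |D| / bracket z.re :=
      ((norm_dbar_le τ z).trans (hD z)).trans
        (div_le_div_of_nonneg_right (le_abs_self D) hb.le)
    rw [norm_mul]
    calc ‖taylorExt n f z‖ * ‖dbar τ z‖ ≤ (K * bracket z.re ^ β) * (|D| / bracket z.re) :=
          mul_le_mul (hK z hz) h4 (norm_nonneg _) (by positivity)
      _ = K * |D| * bracket z.re ^ (β - 1) * 1 := by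
          rw [Real.rpow_sub hb, Real.rpow_one]; field_simp
      _ ≤ _ := by
          refine mul_le_mul_of_nonneg_left (one_le_pow₀ ?_) (by positivity)
          exact (one_le_div hb).2 h
  rw [h1]
  calc ‖dbar (taylorExt n f) z * τ z + taylorExt n f z * dbar τ z‖
      ≤ ‖dbar (taylorExt n f) z * τ z‖ + ‖taylorExt n f z * dbar τ z‖ := norm_add_le _ _
    _ ≤ (|c| * bracket z.re ^ (β - 1) * (|z.im| / bracket z.re) ^ n) * M
        + K * |D| * bracket z.re ^ (β - 1) * (|z.im| / bracket z.re) ^ n := by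
        refine add_le_add ?_ h3
        rw [norm_mul]
        exact mul_le_mul h2 (hM z) (norm_nonneg _) (by positivity)
    _ = _ := by ring

lemma bracket_le_three_mul {z : ℂ} (h : |z.im| ≤ 2 * bracket z.re) :
    bracket z ≤ 3 * bracket z.re := by
  have hb := bracket_pos z.re
  refine Real.sqrt_le_iff.2 ⟨by linarith, ?_⟩
  have h1 := sq_bracket z.re
  rw [Real.norm_eq_abs, sq_abs] at h1
  rw [← Complex.normSq_eq_norm_sq, Complex.normSq_apply]
  have h2 : z.im ^ 2 ≤ (2 * bracket z.re) ^ 2 := by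
    rw [← sq_abs]; exact pow_le_pow_left₀ (abs_nonneg _) h 2
  nlinarith

lemma norm_almostAnalytic_le {β : ℝ} (hβ : β < 0) {f : ℝ → ℂ} (hf : MemS β f) {τ : ℂ → ℂ}
    (hτ : IsCutoff τ) (n : ℕ) :
    ∃ C : ℝ, ∀ z : ℂ, ‖almostAnalytic n τ f z‖ ≤ C * bracket z ^ β := by
  obtain ⟨M, hM0, hM⟩ := hτ.norm_le
  obtain ⟨K, hK0, hK⟩ := norm_taylorExt_le hf n
  refine ⟨K * 3 ^ (-β) * M, fun z => ?_⟩
  have hb := bracket_pos z.re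
  have hbz := bracket_pos z
  rcases le_total (2 * bracket z.re) |z.im| with h | h
  · rw [almostAnalytic, hτ.eq_zero z h, mul_zero, norm_zero]; positivity
  have h1 : bracket z.re ^ β ≤ 3 ^ (-β) * bracket z ^ β := by
    have h2 : bracket z / 3 ≤ bracket z.re := by linarith [bracket_le_three_mul h]
    refine (Real.rpow_le_rpow_of_nonpos (by positivity) h2 hβ.le).trans_eq ?_
    rw [Real.div_rpow hbz.le (by norm_num), Real.rpow_neg (by norm_num)]
    field_simp
  calc ‖almostAnalytic n τ f z‖ = ‖taylorExt n f z‖ * ‖τ z‖ := norm_mul _ _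
    _ ≤ (K * (3 ^ (-β) * bracket z ^ β)) * M :=
        mul_le_mul ((hK z h).trans (mul_le_mul_of_nonneg_left h1 hK0)) (hM z) (norm_nonneg _)
          (by positivity)
    _ = _ := by ring

/-! ### Absolute convergence -/

lemma integrable_bracket_rpow {q : ℝ} (hq : q < -1) :
    Integrable fun x : ℝ => bracket x ^ q := by
  have h := integrable_rpow_neg_one_add_norm_sq (E := ℝ) (μ := volume) (r := -q)
    (by simp; linarith)
  refine h.congr (.of_forall fun x => ?_)
  simp only [bracket, neg_neg]
  rw [Real.sqrt_eq_rpow, ← Real.rpow_mul (by positivity)]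
  ring_nf

lemma integrable_abs_rpow_mul_bracket_rpow {q s : ℝ} (hq : q < -1) (hs : -1 < s) :
    Integrable fun y : ℝ => |y| ^ s * bracket y ^ (q - s) := by
  have hmeas : Measurable fun y : ℝ => |y| ^ s * bracket y ^ (q - s) :=
    (measurable_id.abs.pow_const s).mul (continuous_bracket.measurable.pow_const _)
  have h1 : IntegrableOn (fun y : ℝ => |y| ^ s * bracket y ^ (q - s)) (Set.Ioc 0 1) := by
    have h := (intervalIntegral.integrableOn_Ioo_rpow_iff (s := s) zero_lt_one).2 hs
    rw [← integrableOn_Ioc_iff_integrableOn_Ioo] at h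
    refine Integrable.mono' h hmeas.aestronglyMeasurable ?_
    refine (ae_restrict_iff' measurableSet_Ioc).2 (.of_forall fun y hy => ?_)
    have hb := bracket_pos y
    rw [abs_of_pos hy.1, Real.norm_of_nonneg (by have := hy.1; positivity)]
    exact mul_le_of_le_one_right (by have := hy.1; positivity)
      (Real.rpow_le_one_of_one_le_of_nonpos (one_le_bracket y) (by linarith))
  have h2 : IntegrableOn (fun y : ℝ => |y| ^ s * bracket y ^ (q - s)) (Set.Ioi 1) := by
    refine Integrable.mono' (integrableOn_Ioi_rpow_of_lt hq zero_lt_one)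
      hmeas.aestronglyMeasurable ?_
    refine (ae_restrict_iff' measurableSet_Ioi).2 (.of_forall fun y hy => ?_)
    have hy0 : 0 < y := zero_lt_one.trans hy
    have hb := bracket_pos y
    rw [abs_of_pos hy0, Real.norm_of_nonneg (by positivity)]
    have h3 : y ≤ bracket y := (le_abs_self y).trans (norm_le_bracket y)
    calc y ^ s * bracket y ^ (q - s) ≤ y ^ s * y ^ (q - s) :=
          mul_le_mul_of_nonneg_left (Real.rpow_le_rpow_of_nonpos hy0 h3 (by linarith))
            (by positivity)
      _ = y ^ q := by rw [← Real.rpow_add hy0]; ring_nf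
  have h3 : IntegrableOn (fun y : ℝ => |y| ^ s * bracket y ^ (q - s)) (Set.Ioi 0) := by
    rw [← Set.Ioc_union_Ioi_eq_Ioi zero_le_one]
    exact h1.union h2
  have h4 : IntegrableOn (fun y : ℝ => |y| ^ s * bracket y ^ (q - s)) (Set.Iio 0) := by
    have := IntegrableOn.comp_neg_Iio (c := (0 : ℝ)) (by simpa using h3)
    simpa [bracket] using this
  rw [← integrableOn_univ, ← Set.Iic_union_Ioi (a := (0 : ℝ))]
  exact ((integrableOn_Iic_iff_integrableOn_Iio enorm_ne_top).2 h4).union h3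

/-- A product majorant on `ℂ`. Shifting part of the decay in `⟨x⟩` to `⟨y⟩`, which is possible where
`|y| ≤ 2⟨x⟩`, separates the variables of the integrand of the functional calculus. -/
lemma integrable_majorant {q s : ℝ} (hq : q < -1) (hs : -1 < s) :
    Integrable fun z : ℂ => bracket z.re ^ q * (|z.im| ^ s * bracket z.im ^ (q - s)) := by
  have h := (integrable_bracket_rpow hq).mul_prod (integrable_abs_rpow_mul_bracket_rpow hq hs)
  exact (Complex.volume_preserving_equiv_real_prod.integrable_comp_emb
    Complex.measurableEquivRealProd.measurableEmbedding).2 h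

lemma ae_im_ne_zero : ∀ᵐ z : ℂ, z.im ≠ 0 := by
  have h : ∀ᵐ p : ℝ × ℝ, p.2 ≠ 0 := by
    have : ∀ᵐ y : ℝ, y ≠ 0 := by simp [ae_iff]
    exact Measure.quasiMeasurePreserving_snd.ae this
  exact Complex.volume_preserving_equiv_real_prod.quasiMeasurePreserving.ae h

/-- Absolute convergence of the functional calculus with an arbitrary kernel in place of the
resolvent. -/
theorem integrable_dbar_smul {β : ℝ} (hβ : β < 0) {f : ℝ → ℂ} (hf : MemS β f) {τ : ℂ → ℂ}
    (hτ : IsCutoff τ) {n : ℕ} {α : ℝ} (hα : 0 ≤ α) (hn : α < n) {E : Type*}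
    [NormedAddCommGroup E] [NormedSpace ℂ E] {K : ℂ → E} {c : ℝ}
    (hKc : ContinuousOn K {z | z.im ≠ 0})
    (hK : ∀ z : ℂ, z.im ≠ 0 → ‖K z‖ ≤ c * |z.im|⁻¹ * (bracket z / |z.im|) ^ α) :
    Integrable fun z => dbar (almostAnalytic n τ f) z • K z := by
  obtain ⟨C, hC0, hC⟩ := norm_dbar_almostAnalytic_le hf hτ n
  set s : ℝ := n - 1 - α with hs
  set q : ℝ := β / 2 - 1 with hq
  have hs1 : -1 < s := by rw [hs]; linarith
  have hq1 : q < -1 := by rw [hq]; linarith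
  have hmeas : AEStronglyMeasurable (fun z => dbar (almostAnalytic n τ f) z • K z) volume := by
    have hd : Continuous (dbar (almostAnalytic n τ f)) := by
      have h := (contDiff_almostAnalytic hf.1 hτ n).continuous_fderiv (by simp)
      unfold dbar
      fun_prop
    refine hd.aestronglyMeasurable.smul ?_
    have hopen : IsOpen {z : ℂ | z.im ≠ 0} := isOpen_ne.preimage Complex.continuous_im
    have h := hKc.aestronglyMeasurable (μ := volume) hopen.measurableSet
    rwa [Measure.restrict_eq_self_of_ae_mem (s := {z : ℂ | z.im ≠ 0}) ae_im_ne_zero] at h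
  refine Integrable.mono' ((integrable_majorant hq1 hs1).const_mul
    (C * |c| * 3 ^ α * 3 ^ (-(q - s)))) hmeas ?_
  filter_upwards [ae_im_ne_zero] with z hz
  have hy : 0 < |z.im| := abs_pos.2 hz
  have hb := bracket_pos z.re
  have hby := bracket_pos z.im
  rcases lt_or_ge (2 * bracket z.re) |z.im| with h | h
  · rw [dbar_almostAnalytic_eq_zero hτ n f h, zero_smul, norm_zero]
    positivity
  have hby3 : bracket z.im / 3 ≤ bracket z.re := by
    have h1 : bracket z.im ≤ bracket z :=
      Real.sqrt_le_sqrt (by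
        have := pow_le_pow_left₀ (abs_nonneg _) (Complex.abs_im_le_norm z) 2
        rw [Real.norm_eq_abs]; linarith)
    linarith [bracket_le_three_mul h]
  have hK' : ‖K z‖ ≤ |c| * |z.im|⁻¹ * (3 * bracket z.re / |z.im|) ^ α := by
    refine (hK z hz).trans ?_
    have := bracket_pos z
    have := bracket_le_three_mul h
    gcongr
    exact le_abs_self c
  have hpow : bracket z.re ^ (q - s) ≤ 3 ^ (-(q - s)) * bracket z.im ^ (q - s) := by
    refine (Real.rpow_le_rpow_of_nonpos (by positivity) hby3 (by linarith)).trans_eq ?_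
    rw [Real.div_rpow hby.le (by norm_num), Real.rpow_neg (by norm_num)]
    field_simp
  rw [norm_smul]
  calc ‖dbar (almostAnalytic n τ f) z‖ * ‖K z‖
      ≤ (C * bracket z.re ^ (β - 1) * (|z.im| / bracket z.re) ^ n) *
        (|c| * |z.im|⁻¹ * (3 * bracket z.re / |z.im|) ^ α) :=
        mul_le_mul (hC z h) hK' (norm_nonneg _) (by positivity)
    _ = C * |c| * 3 ^ α * (bracket z.re ^ q * (|z.im| ^ s * bracket z.re ^ (q - s))) := by
        -- Collect the powers of `⟨x⟩` (in total `β - 2 - s = q + (q - s)`) and of `|y|`.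
        have e1 : bracket z.re ^ q * bracket z.re ^ (q - s)
            = bracket z.re ^ (β - 1) * bracket z.re ^ α / bracket z.re ^ n := by
          rw [← Real.rpow_add hb, ← Real.rpow_add hb, ← Real.rpow_natCast, ← Real.rpow_sub hb,
            hq, hs]
          ring_nf
        have e2 : |z.im| ^ s = |z.im| ^ n * |z.im|⁻¹ / |z.im| ^ α := by
          rw [hs, Real.rpow_sub hy, Real.rpow_sub hy, Real.rpow_natCast, Real.rpow_one]
          rfl
        rw [Real.div_rpow (by positivity) hy.le, Real.mul_rpow (by norm_num) hb.le, div_pow]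
        calc _ = C * |c| * 3 ^ α * ((|z.im| ^ n * |z.im|⁻¹ / |z.im| ^ α) *
              (bracket z.re ^ (β - 1) * bracket z.re ^ α / bracket z.re ^ n)) := by ring
          _ = _ := by rw [← e1, ← e2]; ring
    _ ≤ C * |c| * 3 ^ α * (bracket z.re ^ q *
          (|z.im| ^ s * (3 ^ (-(q - s)) * bracket z.im ^ (q - s)))) := by
        gcongr
    _ = _ := by ring

/-! ### The Cauchy–Pompeiu formula -/

section Pompeiu

variable {F : ℂ → ℂ} {l : ℂ}

lemma hasDerivAt_comp_polar_radial (hF : ContDiff ℝ ∞ F) (r θ : ℝ) :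
    HasDerivAt (fun r : ℝ => F (l + r * Complex.exp (θ * Complex.I)))
      (fderiv ℝ F (l + r * Complex.exp (θ * Complex.I)) (Complex.exp (θ * Complex.I))) r := by
  have h1 : HasDerivAt (fun r : ℝ => l + r * Complex.exp (θ * Complex.I))
      (Complex.exp (θ * Complex.I)) r := by
    simpa using (((hasDerivAt_id r).ofReal_comp.mul_const
      (Complex.exp (θ * Complex.I))).const_add l)
  exact ((hF.differentiable (by simp) _).hasFDerivAt.comp_hasDerivAt r h1)

lemma hasDerivAt_comp_polar_angular (hF : ContDiff ℝ ∞ F) (r θ : ℝ) :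
    HasDerivAt (fun θ : ℝ => F (l + r * Complex.exp (θ * Complex.I)))
      (fderiv ℝ F (l + r * Complex.exp (θ * Complex.I))
        (r * (Complex.exp (θ * Complex.I) * Complex.I))) θ := by
  have h1 : HasDerivAt (fun θ : ℝ => l + r * Complex.exp (θ * Complex.I))
      (r * (Complex.exp (θ * Complex.I) * Complex.I)) θ := by
    have h2 : HasDerivAt (fun θ : ℝ => (θ : ℂ) * Complex.I) Complex.I θ := by
      simpa using (hasDerivAt_id θ).ofReal_comp.mul_const Complex.I
    exact (h2.cexp.const_mul (r : ℂ)).const_add l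
  exact ((hF.differentiable (by simp) _).hasFDerivAt.comp_hasDerivAt θ h1)

/-- `2 r (∂F/∂z̄) / (z - l)` is the radial derivative plus `i / r` times the angular derivative. -/
lemma polar_dbar (F : ℂ → ℂ) (l : ℂ) {r : ℝ} (hr : r ≠ 0) (θ : ℝ) :
    2 * (r • (dbar F (l + r * Complex.exp (θ * Complex.I)) *
        (l + r * Complex.exp (θ * Complex.I) - l)⁻¹)) =
      fderiv ℝ F (l + r * Complex.exp (θ * Complex.I)) (Complex.exp (θ * Complex.I)) +
      Complex.I / r * fderiv ℝ F (l + r * Complex.exp (θ * Complex.I))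
        (r * (Complex.exp (θ * Complex.I) * Complex.I)) := by
  set D := fderiv ℝ F (l + r * Complex.exp (θ * Complex.I)) with hD
  have hlin : ∀ w : ℂ, D w = w.re * D 1 + w.im * D Complex.I := by
    intro w
    conv_lhs => rw [← Complex.re_add_im w]
    rw [map_add, show (w.re : ℂ) = w.re • (1 : ℂ) by simp,
      show (w.im : ℂ) * Complex.I = w.im • Complex.I by simp, map_smul, map_smul]
    simp
  have hr' : (r : ℂ) ≠ 0 := by exact_mod_cast hr
  have hexp : Complex.exp (θ * Complex.I) = Real.cos θ + Real.sin θ * Complex.I := by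
    rw [Complex.exp_mul_I]; simp
  have hinv : (Complex.exp (θ * Complex.I))⁻¹ = Real.cos θ - Real.sin θ * Complex.I := by
    rw [← Complex.exp_neg, ← neg_mul, Complex.exp_mul_I]
    simp [sub_eq_add_neg]
  rw [add_sub_cancel_left, mul_inv, hinv, dbar, ← hD, hlin (Complex.exp _), hlin (r * _), hexp]
  simp only [Complex.real_smul]
  simp
  field_simp
  linear_combination (-(D Complex.I) * Complex.sin θ) * Complex.I_sq

lemma continuous_polar : Continuous fun p : ℝ × ℝ => l + p.1 * Complex.exp (p.2 * Complex.I) := by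
  fun_prop

lemma integral_angular_eq_zero (hF : ContDiff ℝ ∞ F) (r : ℝ) :
    (∫ θ in (-Real.pi)..Real.pi, fderiv ℝ F (l + r * Complex.exp (θ * Complex.I))
        (r * (Complex.exp (θ * Complex.I) * Complex.I))) = 0 := by
  have hc := hF.continuous_fderiv (by simp)
  rw [intervalIntegral.integral_eq_sub_of_hasDerivAt
    (fun θ _ => hasDerivAt_comp_polar_angular (l := l) hF r θ)]
  · have h1 : Complex.exp (Real.pi * Complex.I) = -1 := Complex.exp_pi_mul_I
    have h2 : Complex.exp (((-Real.pi : ℝ) : ℂ) * Complex.I) = -1 := by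
      push_cast
      rw [neg_mul, Complex.exp_neg, h1]; norm_num
    rw [h1, h2, sub_self]
  · refine Continuous.intervalIntegrable ?_ _ _
    exact (hc.comp (by fun_prop)).clm_apply (by fun_prop)

lemma hasDerivAt_circle_mean (hF : ContDiff ℝ ∞ F) (r : ℝ) :
    HasDerivAt (fun r : ℝ => ∫ θ in (-Real.pi)..Real.pi, F (l + r * Complex.exp (θ * Complex.I)))
      (∫ θ in (-Real.pi)..Real.pi, fderiv ℝ F (l + r * Complex.exp (θ * Complex.I))
        (Complex.exp (θ * Complex.I))) r := by
  have hc := hF.continuous_fderiv (by simp)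
  have hD : Continuous fun p : ℝ × ℝ => fderiv ℝ F (l + p.1 * Complex.exp (p.2 * Complex.I))
      (Complex.exp (p.2 * Complex.I)) :=
    (hc.comp continuous_polar).clm_apply (by fun_prop)
  obtain ⟨M, hM⟩ := ((isCompact_Icc (a := r - 1) (b := r + 1)).prod
    (isCompact_Icc (a := -Real.pi) (b := Real.pi))).exists_bound_of_continuousOn hD.continuousOn
  have hpi : -Real.pi ≤ Real.pi := by linarith [Real.pi_pos]
  refine (intervalIntegral.hasDerivAt_integral_of_dominated_loc_of_deriv_le
    (s := Set.Icc (r - 1) (r + 1)) (bound := fun _ => M)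
    (F := fun (r : ℝ) (θ : ℝ) => F (l + r * Complex.exp (θ * Complex.I)))
    (F' := fun (r : ℝ) (θ : ℝ) => fderiv ℝ F (l + r * Complex.exp (θ * Complex.I))
        (Complex.exp (θ * Complex.I)))
    (Icc_mem_nhds (by linarith) (by linarith)) (.of_forall fun x => ?_) ?_ ?_
    (.of_forall fun θ hθ x hx => ?_) intervalIntegrable_const
    (.of_forall fun θ _ x _ => hasDerivAt_comp_polar_radial hF x θ)).2
  · exact (hF.continuous.comp (by fun_prop)).aestronglyMeasurable
  · exact (hF.continuous.comp (by fun_prop)).intervalIntegrable _ _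
  · exact (hD.comp (by fun_prop : Continuous fun θ : ℝ => (r, θ))).aestronglyMeasurable
  · rw [Set.uIoc_of_le hpi] at hθ
    exact hM (x, θ) ⟨hx, ⟨hθ.1.le, hθ.2⟩⟩

lemma integrableOn_polar {f : ℂ → ℂ} (hf : Integrable f) :
    IntegrableOn (fun p : ℝ × ℝ => p.1 • f (p.1 * Complex.exp (p.2 * Complex.I)))
      (Set.Ioi 0 ×ˢ Set.Ioo (-Real.pi) Real.pi) := by
  have h1 : Integrable (f ∘ Complex.measurableEquivRealProd.symm) :=
    (Complex.volume_preserving_equiv_real_prod.symm.integrable_comp_emb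
      Complex.measurableEquivRealProd.symm.measurableEmbedding).2 hf
  have h2 := (integrableOn_image_iff_integrableOn_abs_det_fderiv_smul volume
    polarCoord.open_target.measurableSet
    (fun p _ => (hasFDerivAt_polarCoord_symm p).hasFDerivWithinAt) polarCoord.symm.injOn
    (f ∘ Complex.measurableEquivRealProd.symm)).1 h1.integrableOn
  refine h2.congr_fun (fun p hp => ?_) polarCoord.open_target.measurableSet
  have hp1 : 0 < p.1 := hp.1
  simp only [det_fderivPolarCoordSymm, abs_of_pos hp1, Function.comp_apply,
    Complex.measurableEquivRealProd_symm_polarCoord_symm_apply, Complex.polarCoord_symm_apply]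
  rw [Complex.exp_mul_I]
  simp

lemma integral_polar (f : ℂ → ℂ) :
    ∫ p in Set.Ioi (0 : ℝ) ×ˢ Set.Ioo (-Real.pi) Real.pi,
      p.1 • f (p.1 * Complex.exp (p.2 * Complex.I)) = ∫ z, f z := by
  rw [← Complex.integral_comp_polarCoord_symm f]
  refine setIntegral_congr_fun polarCoord.open_target.measurableSet fun p _ => ?_
  simp only [Complex.polarCoord_symm_apply]
  rw [Complex.exp_mul_I]
  simp

/-- The Cauchy–Pompeiu formula on the whole plane, for a smooth function vanishing at infinity. In
polar coordinates around `l` the angular derivative integrates to zero over each circle, and the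
radial one leaves the mean value of `F` over circles shrinking to `l`. -/
theorem integral_dbar_mul_inv (hF : ContDiff ℝ ∞ F)
    (hlim : Filter.Tendsto F (Filter.cocompact ℂ) (nhds 0))
    (hint : Integrable fun z => dbar F z * (z - l)⁻¹) :
    ∫ z, dbar F z * (z - l)⁻¹ = -Real.pi * F l := by
  have hpi : -Real.pi ≤ Real.pi := by linarith [Real.pi_pos]
  have hint' : Integrable fun z => dbar F (l + z) * (l + z - l)⁻¹ :=
    hint.comp_add_left l
  have hpol := integrableOn_polar hint'
  set M : ℝ → ℂ := fun r => ∫ θ in (-Real.pi)..Real.pi, F (l + r * Complex.exp (θ * Complex.I))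
    with hM
  set M' : ℝ → ℂ := fun r => ∫ θ in (-Real.pi)..Real.pi,
    fderiv ℝ F (l + r * Complex.exp (θ * Complex.I)) (Complex.exp (θ * Complex.I)) with hM'
  have hder : ∀ r, HasDerivAt M (M' r) r := hasDerivAt_circle_mean hF
  have hc := hF.continuous_fderiv (by simp)
  have hinner : ∀ r ∈ Set.Ioi (0 : ℝ), (∫ θ in Set.Ioo (-Real.pi) Real.pi,
      r • (dbar F (l + r * Complex.exp (θ * Complex.I)) *
        (l + r * Complex.exp (θ * Complex.I) - l)⁻¹)) = 1 / 2 * M' r := by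
    intro r hr
    rw [← integral_Ioc_eq_integral_Ioo, ← intervalIntegral.integral_of_le hpi]
    have h1 : M' r = ∫ θ in (-Real.pi)..Real.pi,
        (fderiv ℝ F (l + r * Complex.exp (θ * Complex.I)) (Complex.exp (θ * Complex.I)) +
        Complex.I / r * fderiv ℝ F (l + r * Complex.exp (θ * Complex.I))
          (r * (Complex.exp (θ * Complex.I) * Complex.I))) := by
      rw [intervalIntegral.integral_add, intervalIntegral.integral_const_mul,
        integral_angular_eq_zero hF, mul_zero, add_zero]
      · exact ((hc.comp (by fun_prop)).clm_apply (by fun_prop)).intervalIntegrable _ _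
      · exact (continuous_const.mul
          ((hc.comp (by fun_prop)).clm_apply (by fun_prop))).intervalIntegrable _ _
    rw [h1, ← intervalIntegral.integral_const_mul]
    refine intervalIntegral.integral_congr fun θ _ => ?_
    rw [← polar_dbar F l (ne_of_gt hr) θ]
    ring
  rw [IntegrableOn, Measure.volume_eq_prod, ← Measure.prod_restrict] at hpol
  have hM'int : IntegrableOn M' (Set.Ioi 0) := by
    have h1 := hpol.integral_prod_left.const_mul 2
    refine h1.congr ((ae_restrict_iff' measurableSet_Ioi).2 (.of_forall fun r hr => ?_))
    simp only
    rw [hinner r hr]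
    ring
  have hMlim : Filter.Tendsto M Filter.atTop (nhds 0) := by
    rw [Metric.tendsto_atTop]
    intro ε hε
    have hε' : 0 < ε / (4 * Real.pi) := by have := Real.pi_pos; positivity
    obtain ⟨R, hR⟩ := (Filter.hasBasis_cocompact.eventually_iff).1
      (Metric.tendsto_nhds.1 hlim _ hε')
    obtain ⟨ρ, hρ⟩ := hR.1.isBounded.exists_norm_le
    refine ⟨max 0 (ρ + 1 + ‖l‖), fun r hr => ?_⟩
    have hr0 : 0 ≤ r := (le_max_left _ _).trans hr
    have hr1 : ρ + 1 + ‖l‖ ≤ r := (le_max_right _ _).trans hr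
    rw [dist_zero_right]
    have h1 := intervalIntegral.norm_integral_le_of_norm_le_const (a := -Real.pi) (b := Real.pi)
      (f := fun θ : ℝ => F (l + r * Complex.exp (θ * Complex.I))) (C := ε / (4 * Real.pi))
      (fun θ _ => by
        have h2 : l + r * Complex.exp (θ * Complex.I) ∈ Rᶜ := fun hmem => by
          have h3 := hρ _ hmem
          have h4 : ‖(r : ℂ) * Complex.exp (θ * Complex.I)‖ = r := by
            rw [norm_mul, Complex.norm_exp_ofReal_mul_I, mul_one, Complex.norm_real,
              Real.norm_of_nonneg hr0]
          have h5 : ‖(r : ℂ) * Complex.exp (θ * Complex.I)‖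
              ≤ ‖l + r * Complex.exp (θ * Complex.I)‖ + ‖l‖ := by
            calc _ = ‖(l + r * Complex.exp (θ * Complex.I)) - l‖ := by rw [add_sub_cancel_left]
              _ ≤ _ := norm_sub_le _ _
          linarith
        have h6 := hR.2 h2
        rw [dist_zero_right] at h6
        exact h6.le)
    have h2 : ε / (4 * Real.pi) * |Real.pi - -Real.pi| = ε / 2 := by
      have := Real.pi_pos
      rw [abs_of_pos (by linarith)]
      field_simp
      ring
    rw [h2] at h1
    linarith
  have hFTC := integral_Ioi_of_hasDerivAt_of_tendsto (hder 0).continuousAt.continuousWithinAt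
    (fun r _ => hder r) hM'int hMlim
  have hM0 : M 0 = 2 * Real.pi * F l := by
    simp only [hM, Complex.ofReal_zero, zero_mul, add_zero, intervalIntegral.integral_const,
      Complex.real_smul]
    push_cast
    ring
  rw [← integral_add_left_eq_self _ l, ← integral_polar, Measure.volume_eq_prod,
    ← Measure.prod_restrict, integral_prod _ hpol]
  rw [setIntegral_congr_fun measurableSet_Ioi hinner, integral_const_mul, hFTC, hM0]
  ring

end Pompeiu

lemma tendsto_almostAnalytic {β : ℝ} (hβ : β < 0) {f : ℝ → ℂ} (hf : MemS β f) {τ : ℂ → ℂ}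
    (hτ : IsCutoff τ) (n : ℕ) :
    Filter.Tendsto (almostAnalytic n τ f) (Filter.cocompact ℂ) (nhds 0) := by
  obtain ⟨C, hC⟩ := norm_almostAnalytic_le hβ hf hτ n
  refine squeeze_zero_norm hC ?_
  have h1 : Filter.Tendsto (bracket : ℂ → ℝ) (Filter.cocompact ℂ) Filter.atTop :=
    Filter.tendsto_atTop_mono norm_le_bracket (tendsto_norm_cocompact_atTop)
  have h2 := (tendsto_rpow_neg_atTop (neg_pos.2 hβ)).comp h1
  simpa using h2.const_mul C

/-- The functional calculus of the scalar `l` is evaluation at `l`; here `n > 0` makes the integral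
absolutely convergent. -/
theorem integral_dbar_almostAnalytic {β : ℝ} (hβ : β < 0) {f : ℝ → ℂ} (hf : MemS β f) {τ : ℂ → ℂ}
    (hτ : IsCutoff τ) {n : ℕ} (hn : 0 < n) (l : ℝ) :
    ∫ z, dbar (almostAnalytic n τ f) z * (z - l)⁻¹ = -Real.pi * f l := by
  rw [integral_dbar_mul_inv (contDiff_almostAnalytic hf.1 hτ n) (tendsto_almostAnalytic hβ hf hτ n),
    almostAnalytic_ofReal hτ]
  have hne : ∀ z : ℂ, z.im ≠ 0 → z - l ≠ 0 := fun z hz h => hz (by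
    rw [sub_eq_zero.1 h, Complex.ofReal_im])
  refine integrable_dbar_smul hβ hf hτ le_rfl (by exact_mod_cast hn) (c := 1)
    (K := fun z : ℂ => (z - l)⁻¹) ?_ fun z hz => ?_
  · exact ContinuousOn.inv₀ (by fun_prop) hne
  · rw [Real.rpow_zero, mul_one, one_mul, norm_inv]
    refine inv_anti₀ (abs_pos.2 hz) ?_
    simpa using Complex.abs_im_le_norm (z - l)

/-! ### The spectral mapping theorem -/

section SpectralMapping

variable {B : Type*} [NormedAddCommGroup B] [NormedSpace ℂ B] [CompleteSpace B]
  {H : B →ₗ.[ℂ] B} {α : ℝ} {n : ℕ} {τ : ℂ → ℂ}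

omit [CompleteSpace B] in
lemma Admissible.isResolventAt_I (hH : Admissible H α) :
    IsResolventAt H Complex.I (opResolvent H Complex.I) :=
  isResolventAt_opResolvent fun h => by simpa using hH.spectrum_real _ h

theorem integrable_integrand (hH : Admissible H α) (hn : α < n) (hτ : IsCutoff τ) {f : ℝ → ℂ}
    (hf : MemA f) : Integrable (integrand H n τ f) := by
  obtain ⟨β, hβ, hfβ⟩ := hf
  obtain ⟨c, hc⟩ := hH.resolvent_bound
  exact integrable_dbar_smul hβ hfβ hτ hH.exponent_nonneg hn (fun z hz =>
    (differentiableAt_opResolvent hH.isResolventAt_I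
      fun h => hz (hH.spectrum_real z h)).continuousAt.continuousWithinAt) hc

lemma calcHat_mem_bicommutant (hH : Admissible H α) (hn : α < n) (hτ : IsCutoff τ) (φ : AHat) :
    calcHat H n τ φ ∈ bicommutant (opResolvent H Complex.I) := by
  have h1 : ∫ z, integrand H n τ φ.fn z ∈ bicommutant (opResolvent H Complex.I) :=
    integral_mem_bicommutant (integrable_integrand hH hn hτ φ.fn_mem) fun z =>
      Subalgebra.smul_mem _ (opResolvent_mem_bicommutant hH.isResolventAt_I z) _
  have h2 : opCalc H n τ φ.fn = ((-(1 / Real.pi) : ℝ) : ℂ) • ∫ z, integrand H n τ φ.fn z :=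
    (Complex.coe_smul _ _).symm
  rw [calcHat, h2]
  exact add_mem (Subalgebra.smul_mem _ (one_mem _) _) (Subalgebra.smul_mem _ h1 _)

variable {g : (B →L[ℂ] B) →L[ℂ] ℂ}

lemma character_calcHat (hH : Admissible H α) (hn : α < n) (hτ : IsCutoff τ) (φ : AHat)
    (hg : IsBicommutantCharacter (opResolvent H Complex.I) g) :
    g (calcHat H n τ φ) = φ.const - (Real.pi : ℂ)⁻¹ *
      ∫ z, dbar (almostAnalytic n τ φ.fn) z * g (opResolvent H z) := by
  have h1 := g.integral_comp_comm (integrable_integrand hH hn hτ φ.fn_mem)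
  simp only [integrand, map_smul, smul_eq_mul] at h1
  have h2 : opCalc H n τ φ.fn = ((-(1 / Real.pi) : ℝ) : ℂ) • ∫ z, integrand H n τ φ.fn z :=
    (Complex.coe_smul _ _).symm
  have h3 : g (ContinuousLinearMap.id ℂ B) = 1 := hg.map_one
  rw [h1, calcHat, h2, map_add, map_smul, map_smul, h3]
  simp only [integrand, smul_eq_mul]
  push_cast
  ring

lemma character_calcHat_of_eq_zero (hH : Admissible H α) (hn : α < n) (hτ : IsCutoff τ) (φ : AHat)
    (hg : IsBicommutantCharacter (opResolvent H Complex.I) g)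
    (h0 : g (opResolvent H Complex.I) = 0) : g (calcHat H n τ φ) = φ.const := by
  rw [character_calcHat hH hn hτ φ hg]
  simp [hg.map_opResolvent_eq_zero hH.isResolventAt_I h0]

lemma character_calcHat_of_ne_zero (hH : Admissible H α) (hn : α < n) (hτ : IsCutoff τ) (φ : AHat)
    (hg : IsBicommutantCharacter (opResolvent H Complex.I) g)
    (h0 : g (opResolvent H Complex.I) ≠ 0) {l : ℝ}
    (hl : Complex.I - (g (opResolvent H Complex.I))⁻¹ = l) :
    g (calcHat H n τ φ) = φ.eval l := by
  obtain ⟨β, hβ, hfβ⟩ := φ.fn_mem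
  have hn0 : 0 < n := by exact_mod_cast hH.exponent_nonneg.trans_lt hn
  have hint : ∫ z, dbar (almostAnalytic n τ φ.fn) z * g (opResolvent H z) =
      ∫ z, dbar (almostAnalytic n τ φ.fn) z * (z - l)⁻¹ := by
    refine integral_congr_ae ?_
    filter_upwards [ae_im_ne_zero] with z hz
    rw [hg.map_opResolvent hH.isResolventAt_I h0 fun h => hz (hH.spectrum_real z h), hl]
  have hpi : (Real.pi : ℂ) ≠ 0 := by exact_mod_cast Real.pi_ne_zero
  rw [character_calcHat hH hn hτ φ hg, hint, integral_dbar_almostAnalytic hβ hfβ hτ hn0, AHat.eval]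
  field_simp
  ring

theorem specImage_subset_spectrum (hH : Admissible H α) (hn : α < n) (hτ : IsCutoff τ) (φ : AHat) :
    specImage H φ ⊆ spectrum ℂ (calcHat H n τ φ) := by
  rintro _ ⟨x, hx, rfl⟩
  obtain ⟨g, hg, h0, hgx⟩ := exists_character_of_mem_opSpectrum hH.isResolventAt_I hx
  have hval := character_calcHat_of_ne_zero hH hn hτ φ hg h0 hgx
  intro hu
  have h1 := hg.map_inverse (sub_mem (Subalgebra.algebraMap_mem _ (φ.eval x))
    (calcHat_mem_bicommutant hH hn hτ φ)) hu
  rw [map_sub, hg.map_algebraMap, hval, sub_self, zero_mul] at h1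
  exact zero_ne_one h1

omit [CompleteSpace B] in
/-- If the spectrum is unbounded then the value at infinity is approached, since `f` decays. -/
lemma const_mem_closure_specImage (hH : Admissible H α) (φ : AHat)
    (hunb : ∀ r : ℝ, 0 < r → ∃ z ∈ opSpectrum H, r ≤ ‖z‖) :
    φ.const ∈ closure (specImage H φ) := by
  obtain ⟨β, hβ, hfβ⟩ := φ.fn_mem
  obtain ⟨c, hc⟩ := hfβ.2 0
  have hlim : Filter.Tendsto (fun t : ℝ => |c| * t ^ β) Filter.atTop (nhds 0) := by
    have := (tendsto_rpow_neg_atTop (neg_pos.2 hβ)).const_mul |c|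
    simpa using this
  refine Metric.mem_closure_iff.2 fun ε hε => ?_
  obtain ⟨r, hr, hr0⟩ := ((hlim.eventually (gt_mem_nhds hε)).and
    (Filter.eventually_gt_atTop 0)).exists
  obtain ⟨z, hz, hrz⟩ := hunb r hr0
  have hzre : (z.re : ℂ) = z := Complex.ext rfl (by simp [hH.spectrum_real z hz])
  refine ⟨φ.eval z.re, ⟨z.re, by rwa [Set.mem_ofPred_eq, hzre], rfl⟩, ?_⟩
  have h1 : r ≤ bracket z.re := by
    refine hrz.trans ((le_of_eq ?_).trans (norm_le_bracket z.re))
    rw [← hzre, Complex.norm_real]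
    simp
  have h2 := hc z.re
  rw [iteratedDeriv_zero, Nat.cast_zero, sub_zero] at h2
  rw [dist_comm, dist_eq_norm, AHat.eval, add_sub_cancel_left]
  calc ‖φ.fn z.re‖ ≤ |c| * bracket z.re ^ β :=
        h2.trans (mul_le_mul_of_nonneg_right (le_abs_self c)
          (Real.rpow_nonneg (bracket_pos z.re).le _))
    _ ≤ |c| * r ^ β :=
        mul_le_mul_of_nonneg_left (Real.rpow_le_rpow_of_nonpos hr0 h1 hβ.le) (abs_nonneg c)
    _ < ε := hr

theorem spectrum_subset_closure_specImage (hH : Admissible H α) (hn : α < n) (hτ : IsCutoff τ)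
    (φ : AHat) : spectrum ℂ (calcHat H n τ φ) ⊆ closure (specImage H φ) := by
  intro μ hμ
  have hT := hH.isResolventAt_I
  obtain ⟨g, hg, hgμ⟩ := exists_bicommutantCharacter
    (sub_mem (Subalgebra.algebraMap_mem _ μ) (calcHat_mem_bicommutant hH hn hτ φ)) hμ
  rw [map_sub, hg.map_algebraMap, sub_eq_zero] at hgμ
  rw [hgμ]
  by_cases h0 : g (opResolvent H Complex.I) = 0
  · rw [character_calcHat_of_eq_zero hH hn hτ φ hg h0]
    exact const_mem_closure_specImage hH φ fun r hr => exists_norm_ge_mem_opSpectrum hH hT hg h0 hr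
  · have hmem := hg.point_mem_opSpectrum hT h0
    set l := Complex.I - (g (opResolvent H Complex.I))⁻¹ with hl
    have hlre : l = (l.re : ℂ) := Complex.ext rfl (by simp [hH.spectrum_real l hmem])
    rw [character_calcHat_of_ne_zero hH hn hτ φ hg h0 hlre]
    exact subset_closure ⟨l.re, by rwa [Set.mem_ofPred_eq, ← hlre], rfl⟩

end SpectralMapping

end HelfferSjostrand

end

theorem mainTheorem3 {B : Type*} [NormedAddCommGroup B] [NormedSpace ℂ B] [CompleteSpace B]
    (H : B →ₗ.[ℂ] B) (α : ℝ) (hH : HelfferSjostrand.Admissible H α)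
    (n : ℕ) (hn : α < n) (τ : ℂ → ℂ) (hτ : HelfferSjostrand.IsCutoff τ)
    (φ : HelfferSjostrand.AHat) :
    MeasureTheory.Integrable (HelfferSjostrand.integrand H n τ φ.fn) ∧
      closure (HelfferSjostrand.specImage H φ) ⊆
        spectrum ℂ (HelfferSjostrand.calcHat H n τ φ) ∧
      spectrum ℂ (HelfferSjostrand.calcHat H n τ φ) =
        closure (HelfferSjostrand.specImage H φ) := by
  have hsub : closure (HelfferSjostrand.specImage H φ) ⊆
      spectrum ℂ (HelfferSjostrand.calcHat H n τ φ) :=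
    closure_minimal (HelfferSjostrand.specImage_subset_spectrum hH hn hτ φ)
      (spectrum.isClosed _)
  exact ⟨HelfferSjostrand.integrable_integrand hH hn hτ φ.fn_mem, hsub,
    (HelfferSjostrand.spectrum_subset_closure_specImage hH hn hτ φ).antisymm hsub⟩
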